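/- Let $b\in C^2[0,1]$, $d\in C[0,1]$ with $b\ge\beta>0$ and $d-\tfrac12 b''>\delta>0$ on $[0,1]$. For $0<\varepsilon\le 1$ consider the boundary value problem $$\varepsilon^2u^{(4)}-bu''+du=f\ \text{ in }(0,1),\qquad u(0)=u''(0)=u(1)=u''(1)=0 ,$$ and put $w=\varepsilon u''$. Given a mesh $0=x_0<\dots<x_n=1$ and $k\ge1$, let $V_H\subset H_0^1(0,1)$ be the space of continuous functions that vanish at $0$ and $1$ and are polynomials of degree at most $k$ on each mesh interval. The mixed finite element method is: find $(u_H,w_H)\in V_H\times V_H$ such that $$\varepsilon(u_H',\phi')+(w_H,\phi)=0\quad\forall\phi\in V_H,$$ $$(bu_H',\psi')+(b'u_H',\psi)+(du_H,\psi)-\varepsilon(w_H',\psi')=(f,\psi)\quad\forall\psi\in V_H,$$ where $(\cdot,\cdot)$ is the $L_2(0,1)$ inner product. (For constant $b$ the term $(b'u_H',\psi)$ vanishes.) The error is measured in the norm $$\|(v,z)\|_1^2=\|v'\|_{L_2(0,1)}^2+\|z\|_{L_2(0,1)}^2 .$$ Assume that $u\in C^4[0,1]$ is a solution that has a decomposition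 $u=S+E_1+E_2$ with $S,E_1,E_2\in C^{k+2}[0,1]$ and, for $0\le j\le k+2$ and $x\in[0,1]$, $$|S^{(j)}(x)|\le K,\qquad |E_1^{(j)}(x)|\le K\varepsilon^{2-j}e^{-x/\varepsilon},\qquad |E_2^{(j)}(x)|\le K\varepsilon^{2-j}e^{-(1-x)/\varepsilon},$$ with a constant $K$ independent of $\varepsilon$. In both cases below the discrete problem has exactly one solution $(u_H,w_H)$, and the stated error bound holds. 1. (Linear elements, uniform mesh.) Let $k=1$ and let the mesh be uniform with mesh size $H=1/N$, $N\ge1$. Then $$\|(u-u_H,w-w_H)\|_1\le C\,H,$$ where $C$ depends only on $b,d,K$, and not on $\varepsilon$, $N$, $f$, $u$. 2. (Higher order elements.) Let $k\ge2$, $\alpha>0$, $\tau=\varepsilon^{1-3/(2k)}$, and let $\varepsilon$ be so small that $\tau<\tfrac12$. Let the mesh be equidistant with mesh size $h=\tau/M$ in $[0,\tau]$ and in $[1-\tau,1]$, and equidistant with mesh size $H=(1-2\tau)/N$ in $[\tau,1-\tau]$, where $M,N\ge1$ are integers with $h\le\alpha H\tau$ (in particular $h=\alpha H\varepsilon^{1-3/(2k)}$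 is allowed). Then $$\|(u-u_H,w-w_H)\|_1\le C\,H^k,$$ where $C$ depends only on $b,d,K,k,\alpha$, and not on $\varepsilon$, $M$, $N$, $f$, $u$. -/

import Mathlib

open Set MeasureTheory

noncomputable section

namespace VeryWeakLayer

/-- The `j`-th derivative of `g` on `[0,1]` (one-sided at the end points). -/
def D (j : ℕ) (g : ℝ → ℝ) (x : ℝ) : ℝ := iteratedDerivWithin j g (Icc (0 : ℝ) 1) x

/-- `u` is a classical solution of `ε² u⁗ - b u'' + d u = f` in `(0,1)`,
`u(0) = u''(0) = u(1) = u''(1) = 0`. -/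
structure IsSolution (ε : ℝ) (b d f u : ℝ → ℝ) : Prop where
  regular : ContDiffOn ℝ 4 u (Icc 0 1)
  equation : ∀ x ∈ Ioo (0 : ℝ) 1, ε ^ 2 * D 4 u x - b x * D 2 u x + d x * u x = f x
  u_zero : u 0 = 0
  u_one : u 1 = 0
  ddu_zero : D 2 u 0 = 0
  ddu_one : D 2 u 1 = 0

/-- A decomposition `u = S + E₁ + E₂` on `[0,1]` into a smooth part and two very weak layers:
for all orders `j ≤ m`, `|S^(j)| ≤ K`, `|E₁^(j)| ≤ K ε^(2-j) e^(-x/ε)` and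
`|E₂^(j)| ≤ K ε^(2-j) e^(-(1-x)/ε)`. -/
def HasDecomposition (m : ℕ) (ε K : ℝ) (u : ℝ → ℝ) : Prop :=
  ∃ S E₁ E₂ : ℝ → ℝ,
    ContDiffOn ℝ m S (Icc 0 1) ∧ ContDiffOn ℝ m E₁ (Icc 0 1) ∧ ContDiffOn ℝ m E₂ (Icc 0 1) ∧
    (∀ x ∈ Icc (0 : ℝ) 1, u x = S x + E₁ x + E₂ x) ∧
    ∀ j ≤ m, ∀ x ∈ Icc (0 : ℝ) 1,
      |D j S x| ≤ K ∧
      |D j E₁ x| ≤ K * ε ^ (2 - (j : ℤ)) * Real.exp (-x / ε) ∧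
      |D j E₂ x| ≤ K * ε ^ (2 - (j : ℤ)) * Real.exp (-(1 - x) / ε)

/-- `P_k` finite element space in `H_0^1(0,1)` on the mesh `x 0 ≤ x 1 ≤ … ≤ x n`: continuous
functions, zero at `0` and `1` (and extended by zero outside), which are polynomials of degree at
most `k` on each mesh interval. -/
def feSpace (n : ℕ) (x : ℕ → ℝ) (k : ℕ) : Submodule ℝ (ℝ → ℝ) where
  carrier := {v | Continuous v ∧ (∀ y, y ∉ Ioo (0 : ℝ) 1 → v y = 0) ∧
    ∀ i < n, ∃ p : Polynomial ℝ, p.natDegree ≤ k ∧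
      ∀ y ∈ Icc (x i) (x (i + 1)), v y = p.eval y}
  zero_mem' := ⟨continuous_zero, fun _ _ => rfl, fun _ _ => ⟨0, by simp, by simp⟩⟩
  add_mem' := by
    rintro v z ⟨hv, hv0, hvp⟩ ⟨hz, hz0, hzp⟩
    refine ⟨hv.add hz, fun y hy => by simp [hv0 y hy, hz0 y hy], fun i hi => ?_⟩
    obtain ⟨p, hp, hpe⟩ := hvp i hi
    obtain ⟨q, hq, hqe⟩ := hzp i hi
    exact ⟨p + q, Polynomial.natDegree_add_le_of_degree_le hp hq,
      fun y hy => by simp [hpe y hy, hqe y hy]⟩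
  smul_mem' := by
    rintro c v ⟨hv, hv0, hvp⟩
    refine ⟨hv.const_smul c, fun y hy => by simp [hv0 y hy], fun i hi => ?_⟩
    obtain ⟨p, hp, hpe⟩ := hvp i hi
    exact ⟨c • p, (Polynomial.natDegree_smul_le c p).trans hp, fun y hy => by simp [hpe y hy]⟩

/-- `(uH, wH)` is a discrete solution of the mixed method with trial and test functions in
`V × V`. On piecewise polynomials `deriv` is the weak derivative (up to the finitely many mesh
points). The terms `(b u', ψ') + (b' u', ψ)` are the weak form of `-b u''`. -/
structure IsDiscreteSolution (V : Submodule ℝ (ℝ → ℝ)) (ε : ℝ) (b d f uH wH : ℝ → ℝ) : Prop where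
  uH_mem : uH ∈ V
  wH_mem : wH ∈ V
  first : ∀ φ ∈ V,
    ε * (∫ x in (0 : ℝ)..1, deriv uH x * deriv φ x) + (∫ x in (0 : ℝ)..1, wH x * φ x) = 0
  second : ∀ ψ ∈ V,
    (∫ x in (0 : ℝ)..1, b x * deriv uH x * deriv ψ x)
      + (∫ x in (0 : ℝ)..1, D 1 b x * deriv uH x * ψ x)
      + (∫ x in (0 : ℝ)..1, d x * uH x * ψ x)
      - ε * (∫ x in (0 : ℝ)..1, deriv wH x * deriv ψ x)
      = ∫ x in (0 : ℝ)..1, f x * ψ x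

/-- The norm `‖(v,z)‖₁ = (|v|₁² + ‖z‖₀²)^(1/2)` for continuous, piecewise `C¹` functions. -/
def mixedNorm (v z : ℝ → ℝ) : ℝ :=
  Real.sqrt ((∫ x in (0 : ℝ)..1, deriv v x ^ 2) + ∫ x in (0 : ℝ)..1, z x ^ 2)

/-- The uniform mesh with `N` intervals. -/
def uniformMesh (N : ℕ) (i : ℕ) : ℝ := i / N

/-- The mesh with `M` equal intervals in each of `[0,τ]`, `[1-τ,1]` and `N` equal intervals in
`[τ,1-τ]`; it has `M + N + M` intervals. -/
def layerMesh (τ : ℝ) (M N : ℕ) (i : ℕ) : ℝ :=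
  if i ≤ M then i * (τ / M)
  else if i ≤ M + N then τ + ((i : ℝ) - M) * ((1 - 2 * τ) / N)
  else 1 - τ + ((i : ℝ) - M - N) * (τ / M)

/-- The discrete problem on `V` is uniquely solvable, and the error of the discrete solution for
`(u, w)`, `w = ε u''`, is at most `B`. -/
def SolvableWithError (V : Submodule ℝ (ℝ → ℝ)) (ε : ℝ) (b d f u : ℝ → ℝ) (B : ℝ) : Prop :=
  (∃! p : (ℝ → ℝ) × (ℝ → ℝ), IsDiscreteSolution V ε b d f p.1 p.2) ∧
  ∀ uH wH : ℝ → ℝ, IsDiscreteSolution V ε b d f uH wH →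
    mixedNorm (fun x => u x - uH x) (fun x => ε * D 2 u x - wH x) ≤ B

end VeryWeakLayer

end

/-! Add the two discrete equations into one bilinear form on `V × V`. On the diagonal the coupling
terms `-ε(w', ψ')` and `ε(u', φ')` cancel, and integration by parts turns `(b'v', v)` into `-½(b''v,
v)`. So the form controls `β|v|₁² + ‖z‖²` with no trace of `ε` (`mixedForm_coercive`). On a finite
dimensional space this already gives unique solvability (`existsUnique_of_definite`).

For the error, compare the discrete solution with interpolants `I` of `u` and `J` of `w`. The
dangerous consistency terms are `ε((u-I)', φ')` and `ε((w-J)', ψ')`, since the norm does not contain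
`z'`. They vanish if `I'` and `J'` are `L²` projections of `u'` and `w'` onto the derivatives of
`V`. In one dimension this global projection is local: project the derivative onto polynomials of
degree below `k` on each interval and integrate; the result is nodally exact, hence continuous
(`exists_local_interpolant`, `exists_interpolant`). Only `|u-I|₁`, `‖u-I‖` and `‖w-J‖` then remain
(`solvableWithError_of_approximation`).

The interpolation errors involve `h^k u^(k+1)` and `h^k ε u^(k+2)`, both bounded by a multiple of `1
+ ε^(1-k)(e^(-x/ε) + e^(-(1-x)/ε))`. For `k = 1` this is bounded, so a uniform mesh suffices. For `k
≥ 2`, on a fine interval `h^k` supplies `τ^k`, and `τ^k ε^(1-k) = ε^(-1/2)` is exactly what the `L²`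
norm of the exponential, of size `ε^(1/2)`, can absorb (`transition_pow`). On a coarse interval
`e^(-τ/ε) = exp(-ε^(-3/(2k)))` beats every power of `ε` (`layer_decay`). -/

namespace VeryWeakLayer

/-! ### Bounded functions and weak derivatives on the unit interval -/

/-- `g` is essentially bounded on `(0,1)`. -/
def EssBdd (g : ℝ → ℝ) : Prop := MemLp g ⊤ (volume.restrict (Ioc (0 : ℝ) 1))

namespace EssBdd

variable {g h : ℝ → ℝ}

theorem add (hg : EssBdd g) (hh : EssBdd h) : EssBdd fun x => g x + h x := MemLp.add hg hh

theorem sub (hg : EssBdd g) (hh : EssBdd h) : EssBdd fun x => g x - h x := MemLp.sub hg hh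

/-- Closure under products is the reason for working in `L^∞`: integrability of all the integrands
below becomes pure algebra. -/
theorem mul (hg : EssBdd g) (hh : EssBdd h) : EssBdd fun x => g x * h x :=
  MemLp.mul (p := ⊤) (q := ⊤) (r := ⊤) hh hg

theorem sq (hg : EssBdd g) : EssBdd fun x => g x ^ 2 := by
  simpa only [pow_two] using hg.mul hg

theorem const (c : ℝ) : EssBdd fun _ => c := memLp_const c

theorem const_mul (c : ℝ) (hg : EssBdd g) : EssBdd fun x => c * g x := (const c).mul hg

theorem congr (hg : EssBdd g) (hgh : g =ᵐ[volume.restrict (Ioc (0 : ℝ) 1)] h) : EssBdd h :=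
  (memLp_congr_ae hgh).1 hg

theorem of_continuousOn (hg : ContinuousOn g (Icc 0 1)) : EssBdd g := by
  obtain ⟨C, hC⟩ := isCompact_Icc.exists_bound_of_continuousOn hg
  refine memLp_top_of_bound
    ((hg.mono Ioc_subset_Icc_self).aestronglyMeasurable measurableSet_Ioc) C ?_
  filter_upwards [ae_restrict_mem measurableSet_Ioc] with x hx
  exact hC x (Ioc_subset_Icc_self hx)

theorem intervalIntegrable (hg : EssBdd g) {a c : ℝ} (ha : 0 ≤ a) (hac : a ≤ c) (hc : c ≤ 1) :
    IntervalIntegrable g volume a c := by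
  rw [intervalIntegrable_iff_integrableOn_Ioc_of_le hac]
  have : IntegrableOn g (Ioc 0 1) := MemLp.integrable le_top hg
  exact this.mono_set (Ioc_subset_Ioc ha hc)

theorem integrable (hg : EssBdd g) : IntervalIntegrable g volume 0 1 :=
  hg.intervalIntegrable le_rfl zero_le_one le_rfl

end EssBdd

/-- `v` is continuous on `[0,1]` and has the bounded derivative `v'` outside a countable set. -/
structure HasWeakDeriv (v v' : ℝ → ℝ) : Prop where
  continuousOn : ContinuousOn v (Icc 0 1)
  hasDerivAt : ∃ s : Set ℝ, s.Countable ∧ ∀ x ∈ Ioo (0 : ℝ) 1 \ s, HasDerivAt v (v' x) x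
  essBdd_deriv : EssBdd v'

namespace HasWeakDeriv

variable {v v' z z' : ℝ → ℝ}

theorem essBdd (hv : HasWeakDeriv v v') : EssBdd v := .of_continuousOn hv.continuousOn

theorem add (hv : HasWeakDeriv v v') (hz : HasWeakDeriv z z') :
    HasWeakDeriv (fun x => v x + z x) (fun x => v' x + z' x) := by
  obtain ⟨s, hs, hvs⟩ := hv.hasDerivAt
  obtain ⟨t, ht, hzt⟩ := hz.hasDerivAt
  refine ⟨hv.continuousOn.add hz.continuousOn, ⟨s ∪ t, hs.union ht, fun x hx => ?_⟩,
    hv.essBdd_deriv.add hz.essBdd_deriv⟩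
  exact (hvs x ⟨hx.1, fun h => hx.2 (.inl h)⟩).add (hzt x ⟨hx.1, fun h => hx.2 (.inr h)⟩)

theorem const_mul (c : ℝ) (hv : HasWeakDeriv v v') :
    HasWeakDeriv (fun x => c * v x) (fun x => c * v' x) := by
  obtain ⟨s, hs, hvs⟩ := hv.hasDerivAt
  exact ⟨continuousOn_const.mul hv.continuousOn,
    ⟨s, hs, fun x hx => (hvs x hx).const_mul c⟩, hv.essBdd_deriv.const_mul c⟩

theorem sub (hv : HasWeakDeriv v v') (hz : HasWeakDeriv z z') :
    HasWeakDeriv (fun x => v x - z x) (fun x => v' x - z' x) := by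
  simpa only [neg_one_mul, ← sub_eq_add_neg] using hv.add (hz.const_mul (-1))

theorem mul (hv : HasWeakDeriv v v') (hz : HasWeakDeriv z z') :
    HasWeakDeriv (fun x => v x * z x) (fun x => v' x * z x + v x * z' x) := by
  obtain ⟨s, hs, hvs⟩ := hv.hasDerivAt
  obtain ⟨t, ht, hzt⟩ := hz.hasDerivAt
  refine ⟨hv.continuousOn.mul hz.continuousOn, ⟨s ∪ t, hs.union ht, fun x hx => ?_⟩,
    (hv.essBdd_deriv.mul hz.essBdd).add (hv.essBdd.mul hz.essBdd_deriv)⟩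
  exact (hvs x ⟨hx.1, fun h => hx.2 (.inl h)⟩).mul (hzt x ⟨hx.1, fun h => hx.2 (.inr h)⟩)

theorem of_polynomial (p : Polynomial ℝ) :
    HasWeakDeriv (fun x => p.eval x) (fun x => p.derivative.eval x) :=
  ⟨p.continuousOn, ⟨∅, countable_empty, fun x _ => p.hasDerivAt x⟩,
    .of_continuousOn p.derivative.continuousOn⟩

theorem ae_deriv_eq (hv : HasWeakDeriv v v') :
    deriv v =ᵐ[volume.restrict (Ioc (0 : ℝ) 1)] v' := by
  obtain ⟨s, hs, hvs⟩ := hv.hasDerivAt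
  rw [Filter.EventuallyEq, ae_restrict_iff' measurableSet_Ioc]
  filter_upwards [(hs.union (countable_singleton 1)).ae_notMem volume] with x hx hx1
  refine (hvs x ⟨⟨hx1.1, lt_of_le_of_ne hx1.2 fun h => hx (.inr h)⟩, fun h => hx (.inl h)⟩).deriv

theorem integral_eq (hv : HasWeakDeriv v v') {a c : ℝ} (ha : 0 ≤ a) (hac : a ≤ c) (hc : c ≤ 1) :
    ∫ x in a..c, v' x = v c - v a := by
  obtain ⟨s, hs, hvs⟩ := hv.hasDerivAt
  refine integral_eq_of_hasDerivAt_off_countable_of_le v v' hac hs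
    (hv.continuousOn.mono (Icc_subset_Icc ha hc)) (fun x hx => hvs x ⟨?_, hx.2⟩)
    (hv.essBdd_deriv.intervalIntegrable ha hac hc)
  exact ⟨ha.trans_lt hx.1.1, hx.1.2.trans_le hc⟩

/-- Integration by parts when the product vanishes at the end points. -/
theorem integral_mul_deriv (hv : HasWeakDeriv v v') (hz : HasWeakDeriv z z')
    (h0 : v 0 * z 0 = 0) (h1 : v 1 * z 1 = 0) :
    ∫ x in (0 : ℝ)..1, v x * z' x = -∫ x in (0 : ℝ)..1, v' x * z x := by
  have h := (hv.mul hz).integral_eq le_rfl zero_le_one le_rfl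
  rw [intervalIntegral.integral_add (hv.essBdd_deriv.mul hz.essBdd).integrable
    (hv.essBdd.mul hz.essBdd_deriv).integrable, h0, h1] at h
  linarith

end HasWeakDeriv

theorem integral_congr_of_ae {g h : ℝ → ℝ}
    (hgh : g =ᵐ[volume.restrict (Ioc (0 : ℝ) 1)] h) :
    ∫ x in (0 : ℝ)..1, g x = ∫ x in (0 : ℝ)..1, h x := by
  rw [intervalIntegral.integral_of_le zero_le_one, intervalIntegral.integral_of_le zero_le_one]
  exact integral_congr_ae hgh

/-- Cauchy–Schwarz against the constant 1, obtained by expanding the nonnegative integral of `((c -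
a) g - m)²`, where `m` is the integral of `g`. -/
theorem sq_integral_le {g : ℝ → ℝ} (hg : EssBdd g) {a c : ℝ} (ha : 0 ≤ a) (hac : a ≤ c)
    (hc : c ≤ 1) : (∫ x in a..c, g x) ^ 2 ≤ (c - a) * ∫ x in a..c, g x ^ 2 := by
  rcases hac.eq_or_lt with rfl | h
  · simp
  set m := ∫ x in a..c, g x with hm
  have hI : ∀ {f : ℝ → ℝ}, EssBdd f → IntervalIntegrable f volume a c :=
    fun hf => hf.intervalIntegrable ha hac hc
  have h0 : 0 ≤ ∫ x in a..c, ((c - a) * g x - m) ^ 2 :=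
    intervalIntegral.integral_nonneg hac fun _ _ => sq_nonneg _
  have h1 : ∫ x in a..c, ((c - a) * g x - m) ^ 2 =
      (c - a) ^ 2 * (∫ x in a..c, g x ^ 2) - 2 * (c - a) * m * m + (c - a) * m ^ 2 := by
    have : ∀ x, ((c - a) * g x - m) ^ 2 =
        (c - a) ^ 2 * g x ^ 2 - 2 * (c - a) * m * g x + m ^ 2 := fun x => by ring
    simp_rw [this]
    rw [intervalIntegral.integral_add (hI ((hg.sq.const_mul _).sub (hg.const_mul _)))
      (hI (.const _)), intervalIntegral.integral_sub (hI (hg.sq.const_mul _))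
      (hI (hg.const_mul _)), intervalIntegral.integral_const_mul,
      intervalIntegral.integral_const_mul, intervalIntegral.integral_const, smul_eq_mul]
  have h2 : 0 ≤ (c - a) * ((c - a) * (∫ x in a..c, g x ^ 2) - m ^ 2) := by
    rw [h1] at h0; linarith
  nlinarith [nonneg_of_mul_nonneg_right h2 (sub_pos.2 h)]

/-- Poincaré inequality: `v x` is the integral of `v'` from `a`, so Cauchy–Schwarz bounds it
pointwise. The constant is not sharp, but only the power of `c - a` matters. -/
theorem HasWeakDeriv.integral_sq_le {v v' : ℝ → ℝ} (hv : HasWeakDeriv v v') {a c : ℝ}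
    (ha : 0 ≤ a) (hac : a ≤ c) (hc : c ≤ 1) (hva : v a = 0) :
    ∫ x in a..c, v x ^ 2 ≤ (c - a) ^ 2 * ∫ x in a..c, v' x ^ 2 := by
  have hI := hv.essBdd_deriv.sq.intervalIntegrable ha hac hc
  have key : ∀ x ∈ Icc a c, v x ^ 2 ≤ (c - a) * ∫ x in a..c, v' x ^ 2 := by
    intro x hx
    have h1 := hv.integral_eq ha hx.1 (hx.2.trans hc)
    rw [hva, sub_zero] at h1
    rw [← h1]
    refine (sq_integral_le hv.essBdd_deriv ha hx.1 (hx.2.trans hc)).trans ?_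
    have h2 : ∫ x in a..x, v' x ^ 2 ≤ ∫ x in a..c, v' x ^ 2 :=
      intervalIntegral.integral_mono_interval le_rfl hx.1 hx.2
        (Filter.Eventually.of_forall fun _ => sq_nonneg _) hI
    have h3 : 0 ≤ ∫ x in a..x, v' x ^ 2 :=
      intervalIntegral.integral_nonneg hx.1 fun _ _ => sq_nonneg _
    exact mul_le_mul (by linarith [hx.2]) h2 h3 (by linarith)
  calc ∫ x in a..c, v x ^ 2 ≤ ∫ _ in a..c, (c - a) * ∫ x in a..c, v' x ^ 2 :=
        intervalIntegral.integral_mono_on hac (hv.essBdd.sq.intervalIntegrable ha hac hc)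
          intervalIntegrable_const key
    _ = _ := by rw [intervalIntegral.integral_const, smul_eq_mul]; ring

/-! ### Polynomial approximation on one interval -/

/-- Lifts an approximation of a derivative to one of the function, with one value free to prescribe.
-/
theorem exists_derivative_eq {k : ℕ} {p : Polynomial ℝ} (hp : p ∈ Polynomial.degreeLT ℝ k)
    (a y : ℝ) : ∃ q : Polynomial ℝ, q.natDegree ≤ k ∧ q.derivative = p ∧ q.eval a = y := by
  obtain ⟨q, hq, hqp⟩ : ∃ q : Polynomial ℝ, q.natDegree ≤ k ∧ q.derivative = p := by
    refine ⟨∑ i ∈ Finset.range k, Polynomial.monomial (i + 1) (p.coeff i / (i + 1)), ?_, ?_⟩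
    · refine Polynomial.natDegree_sum_le_of_forall_le _ _ fun i hi => ?_
      exact (Polynomial.natDegree_monomial_le _).trans (Finset.mem_range.1 hi)
    · ext n
      simp only [Polynomial.coeff_derivative, Polynomial.finsetSum_coeff,
        Polynomial.coeff_monomial, add_left_inj, Finset.sum_ite_eq', Finset.mem_range]
      split_ifs with h
      · field_simp
      · rw [Polynomial.coeff_eq_zero_of_degree_lt, zero_mul]
        exact (Polynomial.mem_degreeLT.1 hp).trans_le (by exact_mod_cast not_lt.1 h)
  refine ⟨q + Polynomial.C (y - q.eval a), ?_, by simp [hqp], by simp⟩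
  exact Polynomial.natDegree_add_le_of_degree_le hq (by simp)

theorem derivative_mem_degreeLT {k : ℕ} {p : Polynomial ℝ} (hp : p.natDegree ≤ k) :
    p.derivative ∈ Polynomial.degreeLT ℝ k := by
  rw [Polynomial.mem_degreeLT, Polynomial.degree_lt_iff_coeff_zero]
  intro m hm
  rw [Polynomial.coeff_derivative, Polynomial.coeff_eq_zero_of_natDegree_lt (by omega), zero_mul]

/-- Averaged Taylor approximation with an error bound of order `m` in `L²`. -/
theorem exists_polynomial_integral_sq_le {a c : ℝ} (ha : 0 ≤ a) (hac : a ≤ c) (hc : c ≤ 1)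
    (m : ℕ) (G : ℕ → ℝ → ℝ) (hG : ∀ j < m, HasWeakDeriv (G j) (G (j + 1))) :
    ∃ p ∈ Polynomial.degreeLT ℝ m,
      ∫ x in a..c, (G 0 x - p.eval x) ^ 2 ≤ (c - a) ^ (2 * m) * ∫ x in a..c, G m x ^ 2 := by
  induction m generalizing G with
  | zero => exact ⟨0, zero_mem _, by simp⟩
  | succ m ih =>
    -- Approximate the derivative, then integrate from `a`. The error vanishes at `a`, so Poincaré
    -- contributes one more factor `(c - a)²`.
    obtain ⟨p, hp, hpG⟩ := ih (fun j => G (j + 1)) fun j hj => hG (j + 1) (by omega)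
    obtain ⟨q, hq, hqp, hqa⟩ := exists_derivative_eq hp a (G 0 a)
    refine ⟨q, ?_, ?_⟩
    · rw [Polynomial.mem_degreeLT]
      exact Polynomial.degree_lt_iff_coeff_zero _ _ |>.2 fun i hi =>
        Polynomial.coeff_eq_zero_of_natDegree_lt (by omega)
    · have hw := (hG 0 (by omega)).sub (HasWeakDeriv.of_polynomial q)
      refine (hw.integral_sq_le ha hac hc (by simp [hqa])).trans ?_
      rw [hqp]
      calc _ ≤ (c - a) ^ 2 * ((c - a) ^ (2 * m) * ∫ x in a..c, G (m + 1) x ^ 2) :=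
            mul_le_mul_of_nonneg_left hpG (sq_nonneg _)
        _ = _ := by ring

/-- A nonsingular bilinear form on a finite dimensional space represents every functional. -/
theorem existsUnique_of_definite {V : Type*} [AddCommGroup V] [Module ℝ V]
    [FiniteDimensional ℝ V] (B : V →ₗ[ℝ] V →ₗ[ℝ] ℝ) (hB : ∀ v, B v v = 0 → v = 0)
    (l : V →ₗ[ℝ] ℝ) : ∃! v, ∀ z, B v z = l z := by
  have hinj : Function.Injective B := by
    rw [injective_iff_map_eq_zero]
    exact fun v hv => hB v (by rw [hv]; rfl)
  have hsurj : Function.Surjective B :=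
    (LinearMap.injective_iff_surjective_of_finrank_eq_finrank
      (Subspace.dual_finrank_eq (K := ℝ) (V := V)).symm).1 hinj
  obtain ⟨v, hv⟩ := hsurj l
  exact ⟨v, fun z => by rw [hv], fun v' hv' => hinj (by rw [hv]; exact LinearMap.ext hv')⟩

/-- The `L²` projection onto polynomials of degree less than `k`. -/
theorem exists_polynomial_orthogonal {g : ℝ → ℝ} (hg : EssBdd g) {a c : ℝ} (ha : 0 ≤ a)
    (hac : a < c) (hc : c ≤ 1) (k : ℕ) :
    ∃ p ∈ Polynomial.degreeLT ℝ k, ∀ r ∈ Polynomial.degreeLT ℝ k,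
      ∫ x in a..c, (g x - p.eval x) * r.eval x = 0 := by
  have hP : ∀ p : Polynomial ℝ, EssBdd fun x => p.eval x :=
    fun p => .of_continuousOn p.continuousOn
  have hI : ∀ {f : ℝ → ℝ}, EssBdd f → IntervalIntegrable f volume a c :=
    fun hf => hf.intervalIntegrable ha hac.le hc
  let B : Polynomial.degreeLT ℝ k →ₗ[ℝ] Polynomial.degreeLT ℝ k →ₗ[ℝ] ℝ :=
    LinearMap.mk₂ ℝ (fun p r => ∫ x in a..c, (p : Polynomial ℝ).eval x * (r : Polynomial ℝ).eval x)
      (fun p q r => by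
        simp only [Submodule.coe_add, Polynomial.eval_add, add_mul]
        exact intervalIntegral.integral_add (hI ((hP _).mul (hP _))) (hI ((hP _).mul (hP _))))
      (fun s p r => by
        simp only [Submodule.coe_smul, Polynomial.eval_smul, smul_eq_mul, mul_assoc,
          intervalIntegral.integral_const_mul])
      (fun r p q => by
        simp only [Submodule.coe_add, Polynomial.eval_add, mul_add]
        exact intervalIntegral.integral_add (hI ((hP _).mul (hP _))) (hI ((hP _).mul (hP _))))
      (fun s p r => by
        simp only [Submodule.coe_smul, Polynomial.eval_smul, smul_eq_mul, mul_left_comm _ s,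
          intervalIntegral.integral_const_mul])
  let l : Polynomial.degreeLT ℝ k →ₗ[ℝ] ℝ :=
    { toFun := fun r => ∫ x in a..c, g x * (r : Polynomial ℝ).eval x
      map_add' := fun p q => by
        simp only [Submodule.coe_add, Polynomial.eval_add, mul_add]
        exact intervalIntegral.integral_add (hI (hg.mul (hP _))) (hI (hg.mul (hP _)))
      map_smul' := fun s p => by
        simp only [Submodule.coe_smul, Polynomial.eval_smul, smul_eq_mul, mul_left_comm _ s,
          intervalIntegral.integral_const_mul, RingHom.id_apply] }
  -- The Gram form is definite because a nonzero polynomial cannot vanish on all of a nondegenerate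
  -- interval.
  have hB : ∀ p, B p p = 0 → p = 0 := by
    intro p hp
    by_contra hne
    have hne' : (p : Polynomial ℝ) ≠ 0 := fun h => hne (Subtype.ext h)
    have hinf : (Icc a c).Infinite := Icc_infinite hac
    obtain ⟨y, hy, hpy⟩ : ∃ y ∈ Icc a c, (p : Polynomial ℝ).eval y ≠ 0 := by
      by_contra! hall
      exact hne' (Polynomial.eq_zero_of_infinite_isRoot _ (hinf.mono fun y hy => hall y hy))
    have hpos : 0 < ∫ x in a..c, (p : Polynomial ℝ).eval x * (p : Polynomial ℝ).eval x :=
      intervalIntegral.integral_pos hac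
        ((p : Polynomial ℝ).continuousOn.mul (p : Polynomial ℝ).continuousOn)
        (fun x _ => mul_self_nonneg _) ⟨y, hy, mul_self_pos.2 hpy⟩
    exact hpos.ne' hp
  obtain ⟨p, hp, -⟩ := existsUnique_of_definite B hB l
  refine ⟨p, p.2, fun r hr => ?_⟩
  have h := hp ⟨r, hr⟩
  simp only [sub_mul]
  rw [intervalIntegral.integral_sub (hI (hg.mul (hP _))) (hI ((hP _).mul (hP _))), sub_eq_zero]
  exact h.symm

/-- The local Ritz interpolant: nodally exact, orthogonal, and quasi-optimal. -/
theorem exists_local_interpolant {a c : ℝ} (ha : 0 ≤ a) (hac : a < c) (hc : c ≤ 1) {k m : ℕ}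
    (hk : 1 ≤ k) (hm : m ≤ k) (G : ℕ → ℝ → ℝ)
    (hG : ∀ j < m + 1, HasWeakDeriv (G j) (G (j + 1))) :
    ∃ q : Polynomial ℝ, q.natDegree ≤ k ∧ q.eval a = G 0 a ∧ q.eval c = G 0 c ∧
      (∀ r : Polynomial ℝ, r.natDegree ≤ k →
        ∫ x in a..c, (G 1 x - q.derivative.eval x) * r.derivative.eval x = 0) ∧
      ∫ x in a..c, (G 1 x - q.derivative.eval x) ^ 2 ≤
        (c - a) ^ (2 * m) * ∫ x in a..c, G (m + 1) x ^ 2 := by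
  have hP : ∀ p : Polynomial ℝ, EssBdd fun x => p.eval x :=
    fun p => .of_continuousOn p.continuousOn
  have hI : ∀ {f : ℝ → ℝ}, EssBdd f → IntervalIntegrable f volume a c :=
    fun hf => hf.intervalIntegrable ha hac.le hc
  have hG0 := hG 0 (by omega)
  have hG1 : EssBdd (G 1) := hG0.essBdd_deriv
  obtain ⟨p, hp, horth⟩ := exists_polynomial_orthogonal hG1 ha hac hc k
  obtain ⟨q, hq, hqp, hqa⟩ := exists_derivative_eq hp a (G 0 a)
  obtain ⟨t, ht, htG⟩ := exists_polynomial_integral_sq_le ha hac.le hc m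
    (fun j => G (j + 1)) fun j hj => hG (j + 1) (by omega)
  refine ⟨q, hq, hqa, ?_, fun r hr => ?_, ?_⟩
  -- Exactness at the right node: `k ≥ 1` admits the test polynomial 1, so the derivative error has
  -- mean zero and the error at `c` equals that at `a`.
  · have h1 : (1 : Polynomial ℝ) ∈ Polynomial.degreeLT ℝ k := by
      rw [Polynomial.mem_degreeLT, Polynomial.degree_one]
      exact_mod_cast hk
    have h2 := horth 1 h1
    have h3 := (hG0.sub (HasWeakDeriv.of_polynomial q)).integral_eq ha hac.le hc
    simp only [Polynomial.eval_one, mul_one, ← hqp] at h2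
    simp only [zero_add] at h3
    rw [h2, hqa] at h3
    linarith
  · rw [hqp]
    exact horth _ (derivative_mem_degreeLT hr)
  · refine le_trans ?_ htG
    rw [hqp]
    -- Pythagoras: `g - p` is orthogonal to `p - t`, so the projection `p` is at least as good as
    -- the explicit approximation `t`.
    have htk : p - t ∈ Polynomial.degreeLT ℝ k :=
      sub_mem hp (Polynomial.degreeLT_mono hm ht)
    have h1 := horth _ htk
    have hpt : ∀ x, (G 1 x - t.eval x) ^ 2 =
        (G 1 x - p.eval x) ^ 2 + 2 * ((G 1 x - p.eval x) * (p - t).eval x) +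
          (p - t).eval x ^ 2 := fun x => by
      rw [Polynomial.eval_sub]; ring
    simp only [zero_add, hpt]
    have hGp := hG1.sub (hP p)
    rw [intervalIntegral.integral_add (hI (hGp.sq.add ((hGp.mul (hP _)).const_mul 2)))
      (hI (hP _).sq), intervalIntegral.integral_add (hI hGp.sq)
      (hI ((hGp.mul (hP _)).const_mul 2)), intervalIntegral.integral_const_mul, h1]
    have : 0 ≤ ∫ x in a..c, (p - t).eval x ^ 2 :=
      intervalIntegral.integral_nonneg hac.le fun _ _ => sq_nonneg _
    linarith

/-! ### Finite element spaces -/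

/-- A mesh `0 = x 0 < … < x n = 1`. -/
structure IsMesh (n : ℕ) (x : ℕ → ℝ) : Prop where
  zero : x 0 = 0
  last : x n = 1
  lt_succ : ∀ i < n, x i < x (i + 1)

namespace IsMesh

variable {n : ℕ} {x : ℕ → ℝ}

theorem le_of_le (hx : IsMesh n x) {i j : ℕ} (hij : i ≤ j) (hj : j ≤ n) : x i ≤ x j := by
  induction j, hij using Nat.le_induction with
  | base => exact le_rfl
  | succ j hij ih => exact (ih (by omega)).trans (hx.lt_succ j (by omega)).le

theorem nonneg (hx : IsMesh n x) {i : ℕ} (hi : i ≤ n) : 0 ≤ x i :=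
  hx.zero ▸ hx.le_of_le (Nat.zero_le i) hi

theorem le_one (hx : IsMesh n x) {i : ℕ} (hi : i ≤ n) : x i ≤ 1 :=
  hx.last ▸ hx.le_of_le hi le_rfl

theorem exists_mem_Icc (hx : IsMesh n x) {y : ℝ} (hy : y ∈ Icc (0 : ℝ) 1) :
    ∃ i < n, y ∈ Icc (x i) (x (i + 1)) := by
  have key : ∀ m, m ≤ n → y ≤ x m → 0 < m → ∃ i < m, y ∈ Icc (x i) (x (i + 1)) := by
    intro m
    induction m with
    | zero => intro _ _ h; exact absurd h (lt_irrefl 0)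
    | succ m ih =>
      intro hm hym _
      rcases le_total (x m) y with h | h
      · exact ⟨m, m.lt_succ_self, h, hym⟩
      · rcases Nat.eq_zero_or_pos m with rfl | hm0
        · exact ⟨0, Nat.one_pos, hx.zero ▸ hy.1, hym⟩
        · obtain ⟨i, hi, hiy⟩ := ih (by omega) h hm0
          exact ⟨i, by omega, hiy⟩
  refine key n le_rfl (hx.last ▸ hy.2) (Nat.pos_of_ne_zero ?_)
  rintro rfl
  exact zero_ne_one (hx.zero.symm.trans hx.last)

theorem sum_integral (hx : IsMesh n x) {g : ℝ → ℝ} (hg : EssBdd g) :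
    ∑ i ∈ Finset.range n, ∫ y in x i..x (i + 1), g y = ∫ y in (0 : ℝ)..1, g y := by
  rw [intervalIntegral.sum_integral_adjacent_intervals fun i hi =>
    hg.intervalIntegrable (hx.nonneg hi.le) (hx.lt_succ i hi).le (hx.le_one hi), hx.zero, hx.last]

end IsMesh

theorem integral_congr_on_Ioo {g h : ℝ → ℝ} {a c : ℝ} (hac : a ≤ c)
    (hgh : ∀ y ∈ Ioo a c, g y = h y) : ∫ y in a..c, g y = ∫ y in a..c, h y := by
  rw [intervalIntegral.integral_of_le hac, intervalIntegral.integral_of_le hac,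
    integral_Ioc_eq_integral_Ioo, integral_Ioc_eq_integral_Ioo]
  exact setIntegral_congr_fun measurableSet_Ioo hgh

theorem hasDerivAt_of_eqOn_Icc {v : ℝ → ℝ} {a c : ℝ} {p : Polynomial ℝ}
    (hv : ∀ y ∈ Icc a c, v y = p.eval y) {y : ℝ} (hy : y ∈ Ioo a c) :
    HasDerivAt v (p.derivative.eval y) y := by
  refine (p.hasDerivAt y).congr_of_eventuallyEq ?_
  filter_upwards [Icc_mem_nhds hy.1 hy.2] with z hz using hv z hz

section FESpace

variable {n k : ℕ} {x : ℕ → ℝ} {v : ℝ → ℝ}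

theorem feSpace_zero_left (hv : v ∈ feSpace n x k) : v 0 = 0 := hv.2.1 0 (by simp)

theorem hasWeakDeriv_of_mem_feSpace (hx : IsMesh n x) (hv : v ∈ feSpace n x k) :
    HasWeakDeriv v (deriv v) := by
  obtain ⟨hcont, -, hpoly⟩ := hv
  choose! p _ hpv using hpoly
  have hmem : ∀ y ∈ Ioo (0 : ℝ) 1 \ range x, ∃ i < n, y ∈ Ioo (x i) (x (i + 1)) := by
    intro y hy
    obtain ⟨i, hi, hyi⟩ := hx.exists_mem_Icc (Ioo_subset_Icc_self hy.1)
    exact ⟨i, hi, lt_of_le_of_ne hyi.1 fun h => hy.2 ⟨i, h⟩,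
      lt_of_le_of_ne hyi.2 fun h => hy.2 ⟨i + 1, h.symm⟩⟩
  have hbound : ∀ i, ∃ C, 0 ≤ C ∧ ∀ y ∈ Icc (x i) (x (i + 1)), |(p i).derivative.eval y| ≤ C := by
    intro i
    obtain ⟨C, hC⟩ := isCompact_Icc.exists_bound_of_continuousOn
      ((p i).derivative.continuousOn (s := Icc (x i) (x (i + 1))))
    exact ⟨|C|, abs_nonneg C, fun y hy => (hC y hy).trans (le_abs_self C)⟩
  choose C hC0 hC using hbound
  refine ⟨hcont.continuousOn, ⟨range x, countable_range x, fun y hy => ?_⟩, ?_⟩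
  · obtain ⟨i, hi, hyi⟩ := hmem y hy
    exact (hasDerivAt_of_eqOn_Icc (hpv i hi) hyi).differentiableAt.hasDerivAt
  · refine memLp_top_of_bound (measurable_deriv v).aestronglyMeasurable
      -- The sum is a convenient upper bound for the maximum of the piecewise bounds.
      (∑ i ∈ Finset.range n, C i) ?_
    rw [ae_restrict_iff' measurableSet_Ioc]
    filter_upwards [((countable_range x).union (countable_singleton 1)).ae_notMem volume]
      with y hy hy1
    obtain ⟨i, hi, hyi⟩ := hmem y
      ⟨⟨hy1.1, lt_of_le_of_ne hy1.2 fun h => hy (.inr h)⟩, fun h => hy (.inl h)⟩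
    rw [(hasDerivAt_of_eqOn_Icc (hpv i hi) hyi).deriv, Real.norm_eq_abs]
    exact (hC i y (Ioo_subset_Icc_self hyi)).trans
      (Finset.single_le_sum (fun j _ => hC0 j) (Finset.mem_range.2 hi))

/-- Sampling at `k + 1` distinct points of each mesh interval determines a polynomial of degree at
most `k`, so the sampling map is injective. -/
theorem finiteDimensional_feSpace (hx : IsMesh n x) :
    FiniteDimensional ℝ (feSpace n x k) := by
  let y : Fin n → Fin (k + 1) → ℝ := fun i j =>
    x i + (x (i + 1) - x i) * ((j : ℝ) / (k + 1))
  let T : feSpace n x k →ₗ[ℝ] (Fin n → Fin (k + 1) → ℝ) :=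
    { toFun := fun v i j => (v : ℝ → ℝ) (y i j)
      map_add' := fun _ _ => rfl
      map_smul' := fun _ _ => rfl }
  refine FiniteDimensional.of_injective T ?_
  rw [injective_iff_map_eq_zero]
  rintro ⟨v, hv⟩ hTv
  refine Subtype.ext (funext fun z => ?_)
  change v z = 0
  by_cases hz : z ∈ Ioo (0 : ℝ) 1
  swap
  · exact hv.2.1 z hz
  obtain ⟨i, hi, hzi⟩ := hx.exists_mem_Icc (Ioo_subset_Icc_self hz)
  obtain ⟨p, hp, hpv⟩ := hv.2.2 i hi
  have hlt := sub_pos.2 (hx.lt_succ i hi)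
  have hk : (0 : ℝ) < k + 1 := by positivity
  have hp0 : p = 0 := by
    refine Polynomial.eq_zero_of_natDegree_lt_card_of_eval_eq_zero p (f := y ⟨i, hi⟩) ?_ ?_ ?_
    · intro j j' hjj
      have h1 : (x (i + 1) - x i) * ((j : ℝ) / (k + 1)) =
          (x (i + 1) - x i) * ((j' : ℝ) / (k + 1)) := add_left_cancel hjj
      have h2 := mul_left_cancel₀ hlt.ne' h1
      rw [div_left_inj' hk.ne'] at h2
      exact Fin.ext (by exact_mod_cast h2)
    · intro j
      have hj : ((j : ℕ) : ℝ) / (k + 1) ≤ 1 := by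
        rw [div_le_one hk]
        exact_mod_cast j.2.le
      have hj0 : 0 ≤ ((j : ℕ) : ℝ) / (k + 1) := by positivity
      rw [← hpv _ ⟨?_, ?_⟩]
      · exact congrFun (congrFun hTv ⟨i, hi⟩) j
      · have := mul_nonneg hlt.le hj0
        simp only [y]; linarith
      · have := mul_le_mul_of_nonneg_left hj hlt.le
        simp only [y]; linarith
    · simpa using Nat.lt_succ_of_le hp
  rw [hpv z hzi, hp0, Polynomial.eval_zero]

/-- Polynomials on the mesh intervals with matching nodal values form a finite element function. -/
theorem exists_mem_feSpace_eqOn (hx : IsMesh n x) {g : ℝ → ℝ} (hg0 : g 0 = 0) (hg1 : g 1 = 0)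
    {q : ℕ → Polynomial ℝ} (hq : ∀ i < n, (q i).natDegree ≤ k)
    (hql : ∀ i < n, (q i).eval (x i) = g (x i))
    (hqr : ∀ i < n, (q i).eval (x (i + 1)) = g (x (i + 1))) :
    ∃ v ∈ feSpace n x k, ∀ i < n, ∀ y ∈ Icc (x i) (x (i + 1)), v y = (q i).eval y := by
  -- Clamping the argument to the `i`-th interval makes `t i` the increment gained there: zero to
  -- its left, constant to its right. The sum telescopes and is continuous without any gluing
  -- argument.
  let t : ℕ → ℝ → ℝ := fun i y =>
    (q i).eval (max (x i) (min (x (i + 1)) y)) - (q i).eval (x i)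
  have ht_left : ∀ i < n, ∀ y ≤ x i, t i y = 0 := by
    intro i hi y hy
    simp only [t]
    rw [min_eq_right (hy.trans (hx.lt_succ i hi).le), max_eq_left hy, sub_self]
  have ht_mid : ∀ i < n, ∀ y ∈ Icc (x i) (x (i + 1)), t i y = (q i).eval y - g (x i) := by
    intro i hi y hy
    simp only [t]
    rw [min_eq_right hy.2, max_eq_right hy.1, hql i hi]
  have ht_right : ∀ i < n, ∀ y, x (i + 1) ≤ y → t i y = g (x (i + 1)) - g (x i) := by
    intro i hi y hy
    simp only [t]
    rw [min_eq_left hy, max_eq_right (hx.lt_succ i hi).le, hql i hi, hqr i hi]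
  have hsum : ∀ m ≤ n, ∀ y, x m ≤ y → ∑ i ∈ Finset.range m, t i y = g (x m) := by
    intro m hm y hy
    rw [Finset.sum_congr rfl fun i hi => ht_right i
      (by have := Finset.mem_range.1 hi; omega) y
      ((hx.le_of_le (Finset.mem_range.1 hi) hm).trans hy),
      Finset.sum_range_sub fun i => g (x i), hx.zero, hg0, sub_zero]
  have heq : ∀ i < n, ∀ y ∈ Icc (x i) (x (i + 1)),
      ∑ j ∈ Finset.range n, t j y = (q i).eval y := by
    intro i hi y hy
    obtain ⟨r, rfl⟩ : ∃ r, n = (i + 1) + r := ⟨n - (i + 1), by omega⟩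
    rw [Finset.sum_range_add, Finset.sum_range_succ, hsum i hi.le y hy.1, ht_mid i hi y hy,
      Finset.sum_eq_zero fun j hj => ht_left (i + 1 + j)
        (by have := Finset.mem_range.1 hj; omega) y (hy.2.trans (hx.le_of_le (by omega)
        (by have := Finset.mem_range.1 hj; omega)))]
    ring
  refine ⟨fun y => ∑ j ∈ Finset.range n, t j y, ⟨?_, fun y hy => ?_, fun i hi =>
    ⟨q i, hq i hi, heq i hi⟩⟩, heq⟩
  · refine continuous_finsetSum _ fun i _ => ?_
    exact ((q i).continuous.comp (by fun_prop)).sub continuous_const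
  · rcases le_or_gt y 0 with h | h
    · exact Finset.sum_eq_zero fun j hj => ht_left j (Finset.mem_range.1 hj) y
        (h.trans (hx.nonneg (Finset.mem_range.1 hj).le))
    · have h1 : 1 ≤ y := not_lt.1 fun h' => hy ⟨h, h'⟩
      change ∑ j ∈ Finset.range n, t j y = 0
      rw [hsum n le_rfl y (hx.last ▸ h1), hx.last, hg1]

/-- The Ritz interpolant in the finite element space with its error bounds. -/
theorem exists_interpolant (hx : IsMesh n x) {m : ℕ} (hk : 1 ≤ k) (hm : m ≤ k) (G : ℕ → ℝ → ℝ)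
    (hG : ∀ j < m + 1, HasWeakDeriv (G j) (G (j + 1))) (hG0 : G 0 0 = 0) (hG1 : G 0 1 = 0) :
    ∃ v ∈ feSpace n x k,
      (∀ z ∈ feSpace n x k, ∫ y in (0 : ℝ)..1, (G 1 y - deriv v y) * deriv z y = 0) ∧
      ∫ y in (0 : ℝ)..1, (G 1 y - deriv v y) ^ 2 ≤
        ∑ i ∈ Finset.range n,
          (x (i + 1) - x i) ^ (2 * m) * ∫ y in x i..x (i + 1), G (m + 1) y ^ 2 ∧
      ∫ y in (0 : ℝ)..1, (G 0 y - v y) ^ 2 ≤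
        ∑ i ∈ Finset.range n,
          (x (i + 1) - x i) ^ (2 * (m + 1)) * ∫ y in x i..x (i + 1), G (m + 1) y ^ 2 := by
  have hloc : ∀ i, i < n → ∃ q : Polynomial ℝ, q.natDegree ≤ k ∧ q.eval (x i) = G 0 (x i) ∧
      q.eval (x (i + 1)) = G 0 (x (i + 1)) ∧
      (∀ r : Polynomial ℝ, r.natDegree ≤ k →
        ∫ y in x i..x (i + 1), (G 1 y - q.derivative.eval y) * r.derivative.eval y = 0) ∧
      ∫ y in x i..x (i + 1), (G 1 y - q.derivative.eval y) ^ 2 ≤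
        (x (i + 1) - x i) ^ (2 * m) * ∫ y in x i..x (i + 1), G (m + 1) y ^ 2 :=
    fun i hi => exists_local_interpolant (hx.nonneg hi.le) (hx.lt_succ i hi) (hx.le_one hi)
      hk hm G hG
  choose! q hq hql hqr horth happ using hloc
  obtain ⟨v, hv, hvq⟩ := exists_mem_feSpace_eqOn hx hG0 hG1 hq hql hqr
  have hdv := hasWeakDeriv_of_mem_feSpace hx hv
  have hG01 := hG 0 (by omega)
  have hderiv : ∀ i < n, ∀ y ∈ Ioo (x i) (x (i + 1)), deriv v y = (q i).derivative.eval y :=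
    fun i hi y hy => (hasDerivAt_of_eqOn_Icc (hvq i hi) hy).deriv
  have hsq : ∀ i < n, ∫ y in x i..x (i + 1), (G 1 y - deriv v y) ^ 2 ≤
      (x (i + 1) - x i) ^ (2 * m) * ∫ y in x i..x (i + 1), G (m + 1) y ^ 2 := by
    intro i hi
    rw [integral_congr_on_Ioo (hx.lt_succ i hi).le fun y hy => by rw [hderiv i hi y hy]]
    exact happ i hi
  have hmem : ∀ {i}, i ∈ Finset.range n → i < n := Finset.mem_range.1
  refine ⟨v, hv, fun z hz => ?_, ?_, ?_⟩
  · have hdz := hasWeakDeriv_of_mem_feSpace hx hz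
    rw [← hx.sum_integral ((hG01.essBdd_deriv.sub hdv.essBdd_deriv).mul hdz.essBdd_deriv)]
    refine Finset.sum_eq_zero fun i hi => ?_
    obtain ⟨r, hr, hrz⟩ := hz.2.2 i (hmem hi)
    rw [← horth i (hmem hi) r hr]
    refine integral_congr_on_Ioo (hx.lt_succ i (hmem hi)).le fun y hy => ?_
    rw [hderiv i (hmem hi) y hy, (hasDerivAt_of_eqOn_Icc hrz hy).deriv]
  · rw [← hx.sum_integral (hG01.essBdd_deriv.sub hdv.essBdd_deriv).sq]
    exact Finset.sum_le_sum fun i hi => hsq i (hmem hi)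
  · rw [← hx.sum_integral (hG01.essBdd.sub hdv.essBdd).sq]
    refine Finset.sum_le_sum fun i hi => ?_
    have hi' := hmem hi
    have hlt := hx.lt_succ i hi'
    -- The error vanishes at the left node, so the local Poincaré inequality gains one order over
    -- the derivative bound.
    refine ((hG01.sub hdv).integral_sq_le (hx.nonneg hi'.le) hlt.le (hx.le_one hi') ?_).trans ?_
    · rw [hvq i hi' _ (left_mem_Icc.2 hlt.le), hql i hi', sub_self]
    · calc _ ≤ (x (i + 1) - x i) ^ 2 * ((x (i + 1) - x i) ^ (2 * m) *
            ∫ y in x i..x (i + 1), G (m + 1) y ^ 2) :=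
            mul_le_mul_of_nonneg_left (hsq i hi') (sq_nonneg _)
        _ = _ := by ring

end FESpace

/-! ### The mixed bilinear form -/

/-- `T` maps `V` linearly, up to null sets, into the bounded functions. -/
structure IsAELinearOn (V : Submodule ℝ (ℝ → ℝ)) (T : (ℝ → ℝ) → ℝ → ℝ) : Prop where
  essBdd : ∀ v ∈ V, EssBdd (T v)
  add : ∀ v ∈ V, ∀ z ∈ V,
    T (v + z) =ᵐ[volume.restrict (Ioc (0 : ℝ) 1)] fun x => T v x + T z x
  smul : ∀ c : ℝ, ∀ v ∈ V, T (c • v) =ᵐ[volume.restrict (Ioc (0 : ℝ) 1)] fun x => c * T v x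

/-- The bilinear form `(v, z) ↦ (g T v, T' z)`. -/
theorem exists_weightedForm {V : Submodule ℝ (ℝ → ℝ)} {T T' : (ℝ → ℝ) → ℝ → ℝ} {g : ℝ → ℝ}
    (hg : EssBdd g) (hT : IsAELinearOn V T) (hT' : IsAELinearOn V T') :
    ∃ B : V →ₗ[ℝ] V →ₗ[ℝ] ℝ, ∀ v z : V, B v z = ∫ x in (0 : ℝ)..1, g x * T v x * T' z x := by
  have hI : ∀ v z : V, EssBdd fun x => g x * T v x * T' z x := fun v z =>
    (hg.mul (hT.essBdd v v.2)).mul (hT'.essBdd z z.2)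
  refine ⟨LinearMap.mk₂ ℝ (fun v z => ∫ x in (0 : ℝ)..1, g x * T v x * T' z x) ?_ ?_ ?_ ?_,
    fun _ _ => rfl⟩
  · intro v w z
    rw [← intervalIntegral.integral_add (hI v z).integrable (hI w z).integrable]
    refine integral_congr_of_ae ?_
    filter_upwards [hT.add v v.2 w w.2] with x hx
    rw [Submodule.coe_add, hx]; ring
  · intro c v z
    rw [smul_eq_mul, ← intervalIntegral.integral_const_mul]
    refine integral_congr_of_ae ?_
    filter_upwards [hT.smul c v v.2] with x hx
    rw [Submodule.coe_smul, hx]; ring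
  · intro z v w
    rw [← intervalIntegral.integral_add (hI z v).integrable (hI z w).integrable]
    refine integral_congr_of_ae ?_
    filter_upwards [hT'.add v v.2 w w.2] with x hx
    rw [Submodule.coe_add, hx]; ring
  · intro c z v
    rw [smul_eq_mul, ← intervalIntegral.integral_const_mul]
    refine integral_congr_of_ae ?_
    filter_upwards [hT'.smul c v v.2] with x hx
    rw [Submodule.coe_smul, hx]; ring

/-- A space of weakly differentiable functions that vanish outside `(0,1)`. -/
structure IsConforming (V : Submodule ℝ (ℝ → ℝ)) : Prop where
  hasWeakDeriv : ∀ v ∈ V, HasWeakDeriv v (deriv v)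
  eq_zero : ∀ v ∈ V, ∀ x ∉ Ioo (0 : ℝ) 1, v x = 0

namespace IsConforming

variable {V : Submodule ℝ (ℝ → ℝ)}

theorem zero_left (hV : IsConforming V) {v : ℝ → ℝ} (hv : v ∈ V) : v 0 = 0 :=
  hV.eq_zero v hv 0 (by simp)

theorem zero_right (hV : IsConforming V) {v : ℝ → ℝ} (hv : v ∈ V) : v 1 = 0 :=
  hV.eq_zero v hv 1 (by simp)

theorem isAELinearOn_id (hV : IsConforming V) : IsAELinearOn V fun v => v :=
  ⟨fun v hv => (hV.hasWeakDeriv v hv).essBdd, fun _ _ _ _ => .rfl, fun _ _ _ => .rfl⟩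

/-- At a node, kinks may cancel in a sum while `deriv` takes its default value 0 on the summands;
additivity is therefore only claimed almost everywhere. -/
theorem isAELinearOn_deriv (hV : IsConforming V) : IsAELinearOn V deriv :=
  ⟨fun v hv => (hV.hasWeakDeriv v hv).essBdd_deriv,
    fun v hv z hz => ((hV.hasWeakDeriv v hv).add (hV.hasWeakDeriv z hz)).ae_deriv_eq,
    fun c v hv => ((hV.hasWeakDeriv v hv).const_mul c).ae_deriv_eq⟩

theorem integral_sq_le_deriv (hV : IsConforming V) {v : ℝ → ℝ} (hv : v ∈ V) :
    ∫ x in (0 : ℝ)..1, v x ^ 2 ≤ ∫ x in (0 : ℝ)..1, deriv v x ^ 2 := by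
  simpa using (hV.hasWeakDeriv v hv).integral_sq_le le_rfl zero_le_one le_rfl (hV.zero_left hv)

/-- Equality of functions on all of `ℝ` follows because elements of `V` are extended by zero; this
makes uniqueness of the discrete solution literal. -/
theorem eq_zero_of_integral_sq (hV : IsConforming V) {v : ℝ → ℝ} (hv : v ∈ V)
    (h : ∫ x in (0 : ℝ)..1, v x ^ 2 ≤ 0) : v = 0 := by
  funext x
  by_contra hx
  have hmem : x ∈ Ioo (0 : ℝ) 1 := by_contra fun h' => hx (hV.eq_zero v hv x h')
  have : 0 < ∫ x in (0 : ℝ)..1, v x ^ 2 :=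
    intervalIntegral.integral_pos zero_lt_one ((hV.hasWeakDeriv v hv).continuousOn.pow 2)
      (fun _ _ => sq_nonneg _) ⟨x, Ioo_subset_Icc_self hmem, sq_pos_of_ne_zero hx⟩
  exact absurd h (not_le.2 this)

end IsConforming

/-- The bilinear form of the mixed method. -/
theorem exists_mixedForm {V : Submodule ℝ (ℝ → ℝ)} (hV : IsConforming V) (ε : ℝ)
    {b b' d : ℝ → ℝ} (hb : EssBdd b) (hb' : EssBdd b') (hd : EssBdd d) :
    ∃ B : V × V →ₗ[ℝ] V × V →ₗ[ℝ] ℝ, ∀ p z : V × V, B p z =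
      (∫ x in (0 : ℝ)..1, b x * deriv (p.1 : ℝ → ℝ) x * deriv (z.1 : ℝ → ℝ) x)
      + (∫ x in (0 : ℝ)..1, b' x * deriv (p.1 : ℝ → ℝ) x * (z.1 : ℝ → ℝ) x)
      + (∫ x in (0 : ℝ)..1, d x * (p.1 : ℝ → ℝ) x * (z.1 : ℝ → ℝ) x)
      - ε * (∫ x in (0 : ℝ)..1, deriv (p.2 : ℝ → ℝ) x * deriv (z.1 : ℝ → ℝ) x)
      + (ε * (∫ x in (0 : ℝ)..1, deriv (p.1 : ℝ → ℝ) x * deriv (z.2 : ℝ → ℝ) x)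
        + ∫ x in (0 : ℝ)..1, (p.2 : ℝ → ℝ) x * (z.2 : ℝ → ℝ) x) := by
  have h0 := hV.isAELinearOn_id
  have h1 := hV.isAELinearOn_deriv
  obtain ⟨B₁, hB₁⟩ := exists_weightedForm hb h1 h1
  obtain ⟨B₂, hB₂⟩ := exists_weightedForm hb' h1 h0
  obtain ⟨B₃, hB₃⟩ := exists_weightedForm hd h0 h0
  obtain ⟨B₄, hB₄⟩ := exists_weightedForm (EssBdd.const 1) h1 h1
  obtain ⟨B₅, hB₅⟩ := exists_weightedForm (EssBdd.const 1) h0 h0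
  let f := LinearMap.fst ℝ V V
  let s := LinearMap.snd ℝ V V
  refine ⟨B₁.compl₁₂ f f + B₂.compl₁₂ f f + B₃.compl₁₂ f f - ε • B₄.compl₁₂ s f +
    (ε • B₄.compl₁₂ f s + B₅.compl₁₂ s s), fun p z => ?_⟩
  simp [f, s, hB₁, hB₂, hB₃, hB₄, hB₅]

/-- Since `2 v v' = (v²)'`, the convection term equals `-½(b''v, v)` and combines with the reaction
term into a nonnegative integral. -/
theorem mixedForm_coercive {b b' b'' d v : ℝ → ℝ} {β : ℝ} (hb : EssBdd b)
    (hb' : HasWeakDeriv b' b'') (hd : EssBdd d) (hv : HasWeakDeriv v (deriv v))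
    (hv0 : v 0 = 0) (hv1 : v 1 = 0) (hbβ : ∀ x ∈ Icc (0 : ℝ) 1, β ≤ b x)
    (hcoer : ∀ x ∈ Icc (0 : ℝ) 1, 0 ≤ d x - 1 / 2 * b'' x) :
    β * ∫ x in (0 : ℝ)..1, deriv v x ^ 2 ≤
      (∫ x in (0 : ℝ)..1, b x * deriv v x * deriv v x)
      + (∫ x in (0 : ℝ)..1, b' x * deriv v x * v x)
      + ∫ x in (0 : ℝ)..1, d x * v x * v x := by
  have h1 : β * ∫ x in (0 : ℝ)..1, deriv v x ^ 2 ≤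
      ∫ x in (0 : ℝ)..1, b x * deriv v x * deriv v x := by
    rw [← intervalIntegral.integral_const_mul]
    refine intervalIntegral.integral_mono_on zero_le_one (hv.essBdd_deriv.sq.const_mul β).integrable
      ((hb.mul hv.essBdd_deriv).mul hv.essBdd_deriv).integrable fun x hx => ?_
    calc β * deriv v x ^ 2 ≤ b x * deriv v x ^ 2 :=
          mul_le_mul_of_nonneg_right (hbβ x hx) (sq_nonneg _)
      _ = _ := by ring
  have h2 : ∫ x in (0 : ℝ)..1, b' x * deriv v x * v x =
      -(1 / 2) * ∫ x in (0 : ℝ)..1, b'' x * (v x * v x) := by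
    have h := hb'.integral_mul_deriv (hv.mul hv) (by simp [hv0]) (by simp [hv1])
    have h' : ∀ x, b' x * (deriv v x * v x + v x * deriv v x) =
        2 * (b' x * deriv v x * v x) := fun x => by ring
    simp_rw [h', intervalIntegral.integral_const_mul] at h
    linarith
  have h3 : 0 ≤ ∫ x in (0 : ℝ)..1, (d x * v x * v x - 1 / 2 * (b'' x * (v x * v x))) := by
    refine intervalIntegral.integral_nonneg zero_le_one fun x hx => ?_
    have := mul_nonneg (hcoer x hx) (mul_self_nonneg (v x))
    linarith
  rw [intervalIntegral.integral_sub ((hd.mul hv.essBdd).mul hv.essBdd).integrable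
    ((hb'.essBdd_deriv.mul (hv.essBdd.mul hv.essBdd)).const_mul _).integrable,
    intervalIntegral.integral_const_mul] at h3
  linarith

/-- Derivatives on the closed interval as weak derivatives. -/
theorem hasWeakDeriv_D {m : ℕ} {g : ℝ → ℝ} (hg : ContDiffOn ℝ m g (Icc 0 1)) {j : ℕ}
    (hj : j < m) : HasWeakDeriv (D j g) (D (j + 1) g) := by
  have hu := uniqueDiffOn_Icc (zero_lt_one (α := ℝ))
  refine ⟨hg.continuousOn_iteratedDerivWithin (by exact_mod_cast hj.le) hu,
    ⟨∅, countable_empty, fun x hx => ?_⟩,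
    .of_continuousOn (hg.continuousOn_iteratedDerivWithin (by exact_mod_cast hj) hu)⟩
  have hx' := hx.1
  have h := (hg.differentiableOn_iteratedDerivWithin (by exact_mod_cast hj) hu x
    (Ioo_subset_Icc_self hx')).hasDerivWithinAt.hasDerivAt (Icc_mem_nhds hx'.1 hx'.2)
  have hD : D (j + 1) g x = derivWithin (iteratedDerivWithin j g (Icc 0 1)) (Icc 0 1) x := by
    simp only [D, iteratedDerivWithin_succ]
  rw [hD]
  exact h

@[simp] theorem D_zero (g : ℝ → ℝ) : D 0 g = g := by
  funext x; simp [D]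

theorem essBdd_D {m : ℕ} {g : ℝ → ℝ} (hg : ContDiffOn ℝ m g (Icc 0 1)) {j : ℕ}
    (hj : j ≤ m) : EssBdd (D j g) :=
  .of_continuousOn (hg.continuousOn_iteratedDerivWithin (by exact_mod_cast hj)
    (uniqueDiffOn_Icc zero_lt_one))

/-! ### Consistency -/

section Consistency

variable {ε : ℝ} {b d f u : ℝ → ℝ}

theorem IsSolution.load_ae (hu : IsSolution ε b d f u) :
    (fun x => ε ^ 2 * D 4 u x - b x * D 2 u x + d x * u x)
      =ᵐ[volume.restrict (Ioc (0 : ℝ) 1)] f := by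
  rw [Filter.EventuallyEq, ae_restrict_iff' measurableSet_Ioc]
  filter_upwards [(countable_singleton (1 : ℝ)).ae_notMem volume] with x hx hx1
  exact hu.equation x ⟨hx1.1, lt_of_le_of_ne hx1.2 hx⟩

/-- The load carries no regularity assumption of its own; the equation expresses it almost
everywhere through bounded functions. -/
theorem IsSolution.essBdd_load (hu : IsSolution ε b d f u) (hb : EssBdd b) (hd : EssBdd d) :
    EssBdd f := by
  have hr : ContDiffOn ℝ (4 : ℕ) u (Icc 0 1) := hu.regular
  have h0 := essBdd_D hr (Nat.zero_le 4)
  rw [D_zero] at h0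
  exact ((((essBdd_D hr le_rfl).const_mul (ε ^ 2)).sub
    (hb.mul (essBdd_D hr (j := 2) (by norm_num)))).add (hd.mul h0)).congr hu.load_ae

theorem IsSolution.weak_first (hu : IsSolution ε b d f u) {φ : ℝ → ℝ}
    (hφ : HasWeakDeriv φ (deriv φ)) (h0 : φ 0 = 0) (h1 : φ 1 = 0) :
    ε * (∫ x in (0 : ℝ)..1, D 1 u x * deriv φ x) + ∫ x in (0 : ℝ)..1, ε * D 2 u x * φ x = 0 := by
  have hr : ContDiffOn ℝ (4 : ℕ) u (Icc 0 1) := hu.regular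
  rw [(hasWeakDeriv_D hr (j := 1) (by norm_num)).integral_mul_deriv hφ (by simp [h0])
    (by simp [h1])]
  simp only [mul_assoc, intervalIntegral.integral_const_mul]
  ring

/-- Moving the derivative off `ψ` in `(bu', ψ')` yields `-(b'u' + bu'', ψ)`; the term `(b'u', ψ)`
restores the nondivergence form. Here `ε D 3 u` is `w'`. -/
theorem IsSolution.weak_second (hu : IsSolution ε b d f u) (hb : ContDiffOn ℝ 2 b (Icc 0 1))
    (hd : ContinuousOn d (Icc 0 1)) {ψ : ℝ → ℝ}
    (hψ : HasWeakDeriv ψ (deriv ψ)) (h0 : ψ 0 = 0) (h1 : ψ 1 = 0) :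
    (∫ x in (0 : ℝ)..1, b x * D 1 u x * deriv ψ x)
      + (∫ x in (0 : ℝ)..1, D 1 b x * D 1 u x * ψ x)
      + (∫ x in (0 : ℝ)..1, d x * u x * ψ x)
      - ε * (∫ x in (0 : ℝ)..1, ε * D 3 u x * deriv ψ x)
      = ∫ x in (0 : ℝ)..1, f x * ψ x := by
  have hr : ContDiffOn ℝ (4 : ℕ) u (Icc 0 1) := hu.regular
  have hb2 : ContDiffOn ℝ (2 : ℕ) b (Icc 0 1) := hb
  have hbw := hasWeakDeriv_D hb2 (j := 0) (by norm_num)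
  have huw := hasWeakDeriv_D hr (j := 0) (by norm_num)
  rw [D_zero] at hbw huw
  have hd' := EssBdd.of_continuousOn hd
  have h2 := essBdd_D hr (j := 2) (by norm_num)
  have h4 := essBdd_D hr (j := 4) le_rfl
  have e1 := (hbw.mul (hasWeakDeriv_D hr (j := 1) (by norm_num))).integral_mul_deriv hψ
    (by simp [h0]) (by simp [h1])
  have e2 := ((hasWeakDeriv_D hr (j := 3) (by norm_num)).const_mul ε).integral_mul_deriv hψ
    (by simp [h0]) (by simp [h1])
  have e3 : ∫ x in (0 : ℝ)..1, f x * ψ x =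
      ∫ x in (0 : ℝ)..1, (ε * (ε * D 4 u x * ψ x) - b x * D 2 u x * ψ x + d x * u x * ψ x) := by
    refine integral_congr_of_ae ?_
    filter_upwards [hu.load_ae] with x hx
    rw [← hx]; ring
  simp only [zero_add, Nat.reduceAdd] at e1 e2
  have hψb := hψ.essBdd
  simp only [add_mul] at e1
  rw [intervalIntegral.integral_add
    ((hbw.essBdd_deriv.mul huw.essBdd_deriv).mul hψb).integrable
    ((hbw.essBdd.mul h2).mul hψb).integrable] at e1
  rw [e1, e2, e3, intervalIntegral.integral_add
    ((((h4.const_mul ε).mul hψb).const_mul ε).sub ((hbw.essBdd.mul h2).mul hψb)).integrable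
    ((hd'.mul huw.essBdd).mul hψb).integrable,
    intervalIntegral.integral_sub (((h4.const_mul ε).mul hψb).const_mul ε).integrable
    ((hbw.essBdd.mul h2).mul hψb).integrable, intervalIntegral.integral_const_mul]
  ring

end Consistency

/-! ### Unique solvability and the error estimate -/

theorem isConforming_feSpace {n k : ℕ} {x : ℕ → ℝ} (hx : IsMesh n x) :
    IsConforming (feSpace n x k) :=
  ⟨fun _ hv => hasWeakDeriv_of_mem_feSpace hx hv, fun _ hv => hv.2.1⟩

/-- Quasi-optimality: approximations whose derivatives are orthogonal projections control the
error of the mixed method, uniformly in `ε`. -/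
theorem solvableWithError_of_approximation {V : Submodule ℝ (ℝ → ℝ)} [FiniteDimensional ℝ V]
    (hV : IsConforming V) {b d : ℝ → ℝ} (hb : ContDiffOn ℝ 2 b (Icc 0 1))
    (hd : ContinuousOn d (Icc 0 1)) {β L : ℝ} (hβ : 0 < β)
    (hbβ : ∀ x ∈ Icc (0 : ℝ) 1, β ≤ b x)
    (hcoer : ∀ x ∈ Icc (0 : ℝ) 1, 0 ≤ d x - 1 / 2 * D 2 b x)
    (hL : ∀ x ∈ Icc (0 : ℝ) 1, |b x| ≤ L ∧ |D 1 b x| ≤ L ∧ |d x| ≤ L)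
    {ε A : ℝ} {f u : ℝ → ℝ} (hu : IsSolution ε b d f u) {I J : ℝ → ℝ} (hI : I ∈ V) (hJ : J ∈ V)
    (hIo : ∀ v ∈ V, ∫ x in (0 : ℝ)..1, (D 1 u x - deriv I x) * deriv v x = 0)
    (hJo : ∀ v ∈ V, ∫ x in (0 : ℝ)..1, (ε * D 3 u x - deriv J x) * deriv v x = 0)
    (hI1 : ∫ x in (0 : ℝ)..1, (D 1 u x - deriv I x) ^ 2 ≤ A)
    (hI0 : ∫ x in (0 : ℝ)..1, (u x - I x) ^ 2 ≤ A)
    (hJ0 : ∫ x in (0 : ℝ)..1, (ε * D 2 u x - J x) ^ 2 ≤ A) :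
    SolvableWithError V ε b d f u
      (Real.sqrt ((4 + 4 * (6 * L ^ 2 / β + 1 / 2) / min β 1) * A)) := by
  have hr : ContDiffOn ℝ (4 : ℕ) u (Icc 0 1) := hu.regular
  have hb2 : ContDiffOn ℝ (2 : ℕ) b (Icc 0 1) := hb
  have hbB : EssBdd b := .of_continuousOn hb.continuousOn
  have hb'B : EssBdd (D 1 b) := essBdd_D hb2 (by norm_num)
  have hbw := hasWeakDeriv_D hb2 (j := 1) (by norm_num)
  have hdB : EssBdd d := .of_continuousOn hd
  have hfB := hu.essBdd_load hbB hdB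
  have huw := hasWeakDeriv_D hr (j := 0) (by norm_num)
  rw [D_zero, zero_add] at huw
  have hww := (hasWeakDeriv_D hr (j := 2) (by norm_num)).const_mul ε
  have hW := hV.hasWeakDeriv
  obtain ⟨B, hB⟩ := exists_mixedForm hV ε hbB hb'B hdB
  -- With equal arguments the two `ε` terms are negatives of each other, so the bound is uniform in
  -- `ε`.
  have hBpos : ∀ z : V × V, β * (∫ x in (0 : ℝ)..1, deriv (z.1 : ℝ → ℝ) x ^ 2) +
      ∫ x in (0 : ℝ)..1, (z.2 : ℝ → ℝ) x ^ 2 ≤ B z z := by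
    intro z
    have h := mixedForm_coercive hbB hbw hdB (hW z.1 z.1.2) (hV.zero_left z.1.2)
      (hV.zero_right z.1.2) hbβ hcoer
    rw [hB]
    simp only [mul_comm (deriv (z.2 : ℝ → ℝ) _), ← pow_two ((z.2 : ℝ → ℝ) _)]
    linarith
  have hBdef : ∀ z : V × V, B z z = 0 → z = 0 := by
    intro z hz
    have h := hBpos z
    rw [hz] at h
    have h1 : 0 ≤ ∫ x in (0 : ℝ)..1, deriv (z.1 : ℝ → ℝ) x ^ 2 :=
      intervalIntegral.integral_nonneg zero_le_one fun _ _ => sq_nonneg _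
    have h2 : 0 ≤ ∫ x in (0 : ℝ)..1, (z.2 : ℝ → ℝ) x ^ 2 :=
      intervalIntegral.integral_nonneg zero_le_one fun _ _ => sq_nonneg _
    have h3 : ∫ x in (0 : ℝ)..1, deriv (z.1 : ℝ → ℝ) x ^ 2 ≤ 0 :=
      nonpos_of_mul_nonpos_right (by linarith) hβ
    refine Prod.ext (Subtype.ext ?_) (Subtype.ext ?_)
    · exact hV.eq_zero_of_integral_sq z.1.2 ((hV.integral_sq_le_deriv z.1.2).trans h3)
    · exact hV.eq_zero_of_integral_sq z.2.2 (by linarith [mul_nonneg hβ.le h1])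
  let l : V × V →ₗ[ℝ] ℝ :=
    { toFun := fun z => ∫ x in (0 : ℝ)..1, f x * (z.1 : ℝ → ℝ) x
      map_add' := fun z t => by
        simp only [Prod.fst_add, Submodule.coe_add, Pi.add_apply, mul_add]
        exact intervalIntegral.integral_add (hfB.mul (hW _ z.1.2).essBdd).integrable
          (hfB.mul (hW _ t.1.2).essBdd).integrable
      map_smul' := fun c z => by
        simp only [Prod.smul_fst, Submodule.coe_smul, Pi.smul_apply, smul_eq_mul,
          mul_left_comm _ c, intervalIntegral.integral_const_mul, RingHom.id_apply] }
  have hiff : ∀ p : V × V, IsDiscreteSolution V ε b d f p.1 p.2 ↔ ∀ z, B p z = l z := by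
    intro p
    constructor
    · intro h z
      rw [hB, h.first z.2 z.2.2, add_zero]
      exact h.second z.1 z.1.2
    · intro h
      refine ⟨p.1.2, p.2.2, fun φ hφ => ?_, fun ψ hψ => ?_⟩
      · have := h (0, ⟨φ, hφ⟩)
        rw [hB] at this
        simpa [l] using this
      · have := h (⟨ψ, hψ⟩, 0)
        rw [hB] at this
        simpa [l] using this
  refine ⟨?_, fun uH wH hH => ?_⟩
  · obtain ⟨p, hp, huniq⟩ := existsUnique_of_definite B hBdef l
    refine ⟨(p.1, p.2), (hiff p).2 hp, fun q hq => ?_⟩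
    have := huniq (⟨q.1, hq.uH_mem⟩, ⟨q.2, hq.wH_mem⟩) ((hiff _).1 hq)
    rw [← this]
  have hBH := (hiff (⟨uH, hH.uH_mem⟩, ⟨wH, hH.wH_mem⟩)).1 hH
  set zI : V × V := (⟨I, hI⟩, ⟨J, hJ⟩)
  -- The discrete part of the error, interpolant minus discrete solution, serves as its own test
  -- function.
  set z : V × V := zI - (⟨uH, hH.uH_mem⟩, ⟨wH, hH.wH_mem⟩) with hz
  obtain ⟨ξ, hξ⟩ : ∃ ξ : ℝ → ℝ, ξ = z.1 := ⟨_, rfl⟩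
  obtain ⟨η, hη⟩ : ∃ η : ℝ → ℝ, η = z.2 := ⟨_, rfl⟩
  have hξV : ξ ∈ V := hξ ▸ z.1.2
  have hηV : η ∈ V := hη ▸ z.2.2
  have hξI : ∀ x, ξ x = I x - uH x := fun x => by rw [hξ]; rfl
  have hηJ : ∀ x, η x = J x - wH x := fun x => by rw [hη]; rfl
  have hξw := hW ξ hξV
  have hηw := hW η hηV
  have hIw := hW I hI
  have hJw := hW J hJ
  have hp : EssBdd fun x => D 1 u x - deriv I x := huw.essBdd_deriv.sub hIw.essBdd_deriv
  have hP : EssBdd fun x => u x - I x := huw.essBdd.sub hIw.essBdd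
  have hR : EssBdd fun x => ε * D 2 u x - J x := hww.essBdd.sub hJw.essBdd
  -- Galerkin orthogonality moves the error to `(u - I, w - J)`; the projection properties `hIo` and
  -- `hJo` delete both `ε` terms.
  have hres : B z z =
      -((∫ x in (0 : ℝ)..1, b x * (D 1 u x - deriv I x) * deriv ξ x)
      + (∫ x in (0 : ℝ)..1, D 1 b x * (D 1 u x - deriv I x) * ξ x)
      + (∫ x in (0 : ℝ)..1, d x * (u x - I x) * ξ x)
      + ∫ x in (0 : ℝ)..1, (ε * D 2 u x - J x) * η x) := by
    have h1 : B z z = B zI z - l z := by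
      rw [← hBH z, ← LinearMap.sub_apply, ← map_sub]
    have h2 := hu.weak_first hηw (hV.zero_left hηV) (hV.zero_right hηV)
    have h3 := hu.weak_second hb hd hξw (hV.zero_left hξV) (hV.zero_right hξV)
    have h4 := hIo η hηV
    have h5 := hJo ξ hξV
    have hl : l z = ∫ x in (0 : ℝ)..1, f x * ξ x := by rw [hξ]; rfl
    rw [h1, hl, ← h3, hB, ← hξ, ← hη]
    change (∫ x in (0 : ℝ)..1, b x * deriv I x * deriv ξ x)
      + (∫ x in (0 : ℝ)..1, D 1 b x * deriv I x * ξ x)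
      + (∫ x in (0 : ℝ)..1, d x * I x * ξ x)
      - ε * (∫ x in (0 : ℝ)..1, deriv J x * deriv ξ x)
      + (ε * (∫ x in (0 : ℝ)..1, deriv I x * deriv η x)
        + ∫ x in (0 : ℝ)..1, J x * η x) - _ = _
    simp only [mul_sub, sub_mul] at h4 h5 ⊢
    rw [intervalIntegral.integral_sub (huw.essBdd_deriv.mul hηw.essBdd_deriv).integrable
      (hIw.essBdd_deriv.mul hηw.essBdd_deriv).integrable] at h4
    rw [intervalIntegral.integral_sub (hww.essBdd_deriv.mul hξw.essBdd_deriv).integrable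
      (hJw.essBdd_deriv.mul hξw.essBdd_deriv).integrable] at h5
    rw [intervalIntegral.integral_sub
        ((hbB.mul huw.essBdd_deriv).mul hξw.essBdd_deriv).integrable
        ((hbB.mul hIw.essBdd_deriv).mul hξw.essBdd_deriv).integrable,
      intervalIntegral.integral_sub
        ((hb'B.mul huw.essBdd_deriv).mul hξw.essBdd).integrable
        ((hb'B.mul hIw.essBdd_deriv).mul hξw.essBdd).integrable,
      intervalIntegral.integral_sub
        ((hdB.mul huw.essBdd).mul hξw.essBdd).integrable
        ((hdB.mul hIw.essBdd).mul hξw.essBdd).integrable,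
      intervalIntegral.integral_sub
        (hww.essBdd.mul hηw.essBdd).integrable (hJw.essBdd.mul hηw.essBdd).integrable]
    linear_combination h2 - ε * h4 + ε * h5
  -- Young's inequality with weight `β / 8`: it is used three times, so after Poincaré only `3β/8`
  -- of the coercivity in `Q` is spent.
  have hyoung : ∀ c y t : ℝ, |c| ≤ L → -(β / 8) * t ^ 2 - 2 * L ^ 2 / β * y ^ 2 ≤ c * y * t := by
    intro c y t hc
    have h1 : c ^ 2 ≤ L ^ 2 := sq_le_sq' (abs_le.1 hc).1 (abs_le.1 hc).2
    have h2 : 0 ≤ 2 / β * (β / 4 * t + c * y) ^ 2 := by positivity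
    have h3 : 2 / β * (β / 4 * t + c * y) ^ 2 =
        β / 8 * t ^ 2 + c * y * t + 2 * c ^ 2 / β * y ^ 2 := by
      field_simp; ring
    have h4 : 2 * c ^ 2 / β * y ^ 2 ≤ 2 * L ^ 2 / β * y ^ 2 := by gcongr
    linarith
  have hmono : ∀ {c y t : ℝ → ℝ}, EssBdd c → EssBdd y → EssBdd t →
      (∀ x ∈ Icc (0 : ℝ) 1, |c x| ≤ L) →
      -(β / 8) * (∫ x in (0 : ℝ)..1, t x ^ 2) - 2 * L ^ 2 / β * ∫ x in (0 : ℝ)..1, y x ^ 2 ≤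
        ∫ x in (0 : ℝ)..1, c x * y x * t x := by
    intro c y t hc hy ht hcL
    rw [← intervalIntegral.integral_const_mul, ← intervalIntegral.integral_const_mul,
      ← intervalIntegral.integral_sub
      (ht.sq.const_mul _).integrable (hy.sq.const_mul _).integrable]
    exact intervalIntegral.integral_mono_on zero_le_one
      ((ht.sq.const_mul _).integrable.sub (hy.sq.const_mul _).integrable)
      ((hc.mul hy).mul ht).integrable fun x hx => hyoung _ _ _ (hcL x hx)
  have m1 := hmono hbB hp hξw.essBdd_deriv fun x hx => (hL x hx).1
  have m2 := hmono hb'B hp hξw.essBdd fun x hx => (hL x hx).2.1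
  have m3 := hmono hdB hP hξw.essBdd fun x hx => (hL x hx).2.2
  have m4 : -(1 / 2) * (∫ x in (0 : ℝ)..1, η x ^ 2) -
      1 / 2 * ∫ x in (0 : ℝ)..1, (ε * D 2 u x - J x) ^ 2 ≤
        ∫ x in (0 : ℝ)..1, (ε * D 2 u x - J x) * η x := by
    rw [← intervalIntegral.integral_const_mul, ← intervalIntegral.integral_const_mul,
      ← intervalIntegral.integral_sub
      (hηw.essBdd.sq.const_mul _).integrable (hR.sq.const_mul _).integrable]
    refine intervalIntegral.integral_mono_on zero_le_one
      ((hηw.essBdd.sq.const_mul _).integrable.sub (hR.sq.const_mul _).integrable)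
      (hR.mul hηw.essBdd).integrable fun x _ => ?_
    linarith [sq_nonneg (ε * D 2 u x - J x + η x)]
  have hpos := hBpos z
  rw [← hξ, ← hη, hres] at hpos
  have hpoin := hV.integral_sq_le_deriv hξV
  set Q := ∫ x in (0 : ℝ)..1, deriv ξ x ^ 2
  set R := ∫ x in (0 : ℝ)..1, η x ^ 2
  have hQ0 : 0 ≤ Q := intervalIntegral.integral_nonneg zero_le_one fun _ _ => sq_nonneg _
  have hR0 : 0 ≤ R := intervalIntegral.integral_nonneg zero_le_one fun _ _ => sq_nonneg _
  have hA0 : 0 ≤ A := le_trans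
    (intervalIntegral.integral_nonneg zero_le_one fun _ _ => sq_nonneg _) hI0
  have hmin : 0 < min β 1 := lt_min hβ one_pos
  have hQR : Q + R ≤ 2 * (6 * L ^ 2 / β + 1 / 2) / min β 1 * A := by
    have hc : 0 ≤ 2 * L ^ 2 / β := by positivity
    have n1 := mul_le_mul_of_nonneg_left hI1 hc
    have n2 := mul_le_mul_of_nonneg_left hI0 hc
    have n3 := mul_le_mul_of_nonneg_left hpoin hβ.le
    have n4 : min β 1 * Q ≤ β * Q := mul_le_mul_of_nonneg_right (min_le_left _ _) hQ0
    have n5 : min β 1 * R ≤ 1 * R := mul_le_mul_of_nonneg_right (min_le_right _ _) hR0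
    have n6 : 0 ≤ β * Q := mul_nonneg hβ.le hQ0
    have n7 : 6 * L ^ 2 / β * A = 3 * (2 * L ^ 2 / β * A) := by ring
    rw [div_mul_eq_mul_div, le_div_iff₀ hmin]
    linarith
  have e1 : ∫ x in (0 : ℝ)..1, deriv (fun y => u y - uH y) x ^ 2 ≤ 2 * A + 2 * Q := by
    have hw := huw.sub (hW uH hH.uH_mem)
    have hξ' := (hIw.sub (hW uH hH.uH_mem)).ae_deriv_eq
    have hξf : (fun x => I x - uH x) = ξ := funext fun x => (hξI x).symm
    rw [hξf] at hξ'
    calc ∫ x in (0 : ℝ)..1, deriv (fun y => u y - uH y) x ^ 2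
        = ∫ x in (0 : ℝ)..1, (D 1 u x - deriv I x + deriv ξ x) ^ 2 := by
          refine integral_congr_of_ae ?_
          filter_upwards [hw.ae_deriv_eq, hξ'] with x h1 h2
          rw [h1, h2]; ring
      _ ≤ ∫ x in (0 : ℝ)..1, (2 * (D 1 u x - deriv I x) ^ 2 + 2 * deriv ξ x ^ 2) := by
          refine intervalIntegral.integral_mono_on zero_le_one
            (hp.add hξw.essBdd_deriv).sq.integrable
            ((hp.sq.const_mul 2).add (hξw.essBdd_deriv.sq.const_mul 2)).integrable fun x _ => ?_
          linarith [sq_nonneg (D 1 u x - deriv I x - deriv ξ x)]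
      _ ≤ 2 * A + 2 * Q := by
          rw [intervalIntegral.integral_add (hp.sq.const_mul 2).integrable
            (hξw.essBdd_deriv.sq.const_mul 2).integrable,
            intervalIntegral.integral_const_mul, intervalIntegral.integral_const_mul]
          linarith
  have e2 : ∫ x in (0 : ℝ)..1, (ε * D 2 u x - wH x) ^ 2 ≤ 2 * A + 2 * R := by
    have hw := hww.essBdd.sub (hW wH hH.wH_mem).essBdd
    calc ∫ x in (0 : ℝ)..1, (ε * D 2 u x - wH x) ^ 2
        ≤ ∫ x in (0 : ℝ)..1, (2 * (ε * D 2 u x - J x) ^ 2 + 2 * η x ^ 2) := by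
          refine intervalIntegral.integral_mono_on zero_le_one hw.sq.integrable
            ((hR.sq.const_mul 2).add (hηw.essBdd.sq.const_mul 2)).integrable fun x _ => ?_
          have := hηJ x
          have h2 : ε * D 2 u x - wH x = (ε * D 2 u x - J x) + η x := by rw [this]; ring
          rw [h2]
          linarith [sq_nonneg (ε * D 2 u x - J x - η x)]
      _ ≤ 2 * A + 2 * R := by
          rw [intervalIntegral.integral_add (hR.sq.const_mul 2).integrable
            (hηw.essBdd.sq.const_mul 2).integrable,
            intervalIntegral.integral_const_mul, intervalIntegral.integral_const_mul]
          linarith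
  refine Real.sqrt_le_sqrt ?_
  have : (4 + 4 * (6 * L ^ 2 / β + 1 / 2) / min β 1) * A =
      4 * A + 2 * (2 * (6 * L ^ 2 / β + 1 / 2) / min β 1 * A) := by ring
  rw [this]
  linarith

/-- Error bound on a general mesh in terms of a pointwise bound of the scaled derivatives. -/
theorem solvableWithError_feSpace {n k : ℕ} {x : ℕ → ℝ} (hx : IsMesh n x) (hk : 1 ≤ k)
    {b d : ℝ → ℝ} (hb : ContDiffOn ℝ 2 b (Icc 0 1))
    (hd : ContinuousOn d (Icc 0 1)) {β L : ℝ} (hβ : 0 < β)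
    (hbβ : ∀ x ∈ Icc (0 : ℝ) 1, β ≤ b x)
    (hcoer : ∀ x ∈ Icc (0 : ℝ) 1, 0 ≤ d x - 1 / 2 * D 2 b x)
    (hL : ∀ x ∈ Icc (0 : ℝ) 1, |b x| ≤ L ∧ |D 1 b x| ≤ L ∧ |d x| ≤ L)
    {ε A : ℝ} {f u g : ℝ → ℝ} (hu : IsSolution ε b d f u)
    (hur : ContDiffOn ℝ (k + 2 : ℕ) u (Icc 0 1)) (hg : EssBdd g)
    (hgA : ∫ y in (0 : ℝ)..1, g y ≤ A)
    (hug : ∀ i < n, ∀ y ∈ Icc (x i) (x (i + 1)),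
      (x (i + 1) - x i) ^ (2 * k) * D (k + 1) u y ^ 2 ≤ g y ∧
      (x (i + 1) - x i) ^ (2 * k) * (ε * D (k + 2) u y) ^ 2 ≤ g y) :
    SolvableWithError (feSpace n x k) ε b d f u
      (Real.sqrt ((4 + 4 * (6 * L ^ 2 / β + 1 / 2) / min β 1) * A)) := by
  have := finiteDimensional_feSpace (k := k) hx
  have hsum : ∀ {q : ℝ → ℝ}, EssBdd q → (∀ i < n, ∀ y ∈ Icc (x i) (x (i + 1)),
      (x (i + 1) - x i) ^ (2 * k) * q y ^ 2 ≤ g y) →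
      ∑ i ∈ Finset.range n, (x (i + 1) - x i) ^ (2 * k) * ∫ y in x i..x (i + 1), q y ^ 2 ≤ A := by
    intro q hq hqg
    refine le_trans ?_ hgA
    rw [← hx.sum_integral hg]
    refine Finset.sum_le_sum fun i hi => ?_
    have hi' := Finset.mem_range.1 hi
    have hlt := hx.lt_succ i hi'
    rw [← intervalIntegral.integral_const_mul]
    exact intervalIntegral.integral_mono_on hlt.le
      ((hq.sq.const_mul _).intervalIntegrable (hx.nonneg hi'.le) hlt.le (hx.le_one hi'))
      (hg.intervalIntegrable (hx.nonneg hi'.le) hlt.le (hx.le_one hi')) (hqg i hi')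
  obtain ⟨I, hI, hIo, hI1, -⟩ := exists_interpolant hx hk le_rfl (fun j => D j u)
    (fun j hj => hasWeakDeriv_D hur (by omega)) (by simp [hu.u_zero]) (by simp [hu.u_one])
  -- For `w` only the `L²` error counts, which is one order better than the derivative error. Order
  -- `k - 1` therefore suffices and stops at `ε u^(k+2)`.
  obtain ⟨m, rfl⟩ : ∃ m, k = m + 1 := ⟨k - 1, by omega⟩
  obtain ⟨J, hJ, hJo, -, hJ0⟩ := exists_interpolant hx hk (Nat.le_succ m)
    (fun j y => ε * D (j + 2) u y)
    (fun j hj => (hasWeakDeriv_D hur (by omega)).const_mul ε) (by simp [hu.ddu_zero])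
    (by simp [hu.ddu_one])
  have hA1 := hI1.trans (hsum (essBdd_D hur (by omega)) fun i hi y hy => (hug i hi y hy).1)
  have hA2 := hJ0.trans (hsum ((essBdd_D hur (by omega)).const_mul ε)
    fun i hi y hy => (hug i hi y hy).2)
  have hdu := hasWeakDeriv_D hur (j := 0) (by omega)
  rw [D_zero] at hdu
  refine solvableWithError_of_approximation (isConforming_feSpace hx) hb hd hβ hbβ hcoer hL hu
    hI hJ hIo hJo hA1 (le_trans ?_ hA1) hA2
  -- The `L²` error of `I` is bounded by its derivative error through Poincaré on the whole unit
  -- interval.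
  simpa using (hdu.sub (hasWeakDeriv_of_mem_feSpace hx hI)).integral_sq_le le_rfl zero_le_one
    le_rfl (by simp [hu.u_zero, feSpace_zero_left hI])

/-! ### Bounds from the decomposition -/

theorem HasDecomposition.contDiffOn {m : ℕ} {ε K : ℝ} {u : ℝ → ℝ}
    (h : HasDecomposition m ε K u) : ContDiffOn ℝ m u (Icc 0 1) := by
  obtain ⟨S, E₁, E₂, hS, h1, h2, hu, -⟩ := h
  exact ((hS.add h1).add h2).congr hu

theorem HasDecomposition.abs_D_le {m : ℕ} {ε K : ℝ} {u : ℝ → ℝ}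
    (h : HasDecomposition m ε K u) {j : ℕ} (hj : j ≤ m) {x : ℝ} (hx : x ∈ Icc (0 : ℝ) 1) :
    |D j u x| ≤ K * (1 + ε ^ (2 - (j : ℤ)) *
      (Real.exp (-x / ε) + Real.exp (-(1 - x) / ε))) := by
  obtain ⟨S, E₁, E₂, hS, h1, h2, hu, hb⟩ := h
  have hun := uniqueDiffOn_Icc (zero_lt_one (α := ℝ))
  have hjm : (j : WithTop ℕ∞) ≤ m := by exact_mod_cast hj
  have e : D j u x = D j S x + D j E₁ x + D j E₂ x := by
    have hu' : EqOn u (S + E₁ + E₂) (Icc 0 1) := hu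
    have h12 : ContDiffOn ℝ m (S + E₁) (Icc 0 1) := hS.add h1
    simp only [D]
    rw [iteratedDerivWithin_congr hu' hx, iteratedDerivWithin_add hx hun
      ((h12 x hx).of_le hjm) ((h2 x hx).of_le hjm), iteratedDerivWithin_add hx hun
      ((hS x hx).of_le hjm) ((h1 x hx).of_le hjm)]
  obtain ⟨b0, b1, b2⟩ := hb j hj x hx
  rw [e]
  calc _ ≤ |D j S x| + |D j E₁ x| + |D j E₂ x| := abs_add_three _ _ _
    _ ≤ K + K * ε ^ (2 - (j : ℤ)) * Real.exp (-x / ε) +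
        K * ε ^ (2 - (j : ℤ)) * Real.exp (-(1 - x) / ε) := add_le_add (add_le_add b0 b1) b2
    _ = _ := by ring

theorem HasDecomposition.nonneg {m : ℕ} {ε K : ℝ} {u : ℝ → ℝ}
    (h : HasDecomposition m ε K u) : 0 ≤ K := by
  obtain ⟨S, E₁, E₂, -, -, -, -, hb⟩ := h
  exact (abs_nonneg _).trans (hb 0 (Nat.zero_le m) 0 (by simp)).1

/-- The derivatives of `u` and `w` that enter the interpolation error have the same bound. -/
theorem HasDecomposition.sq_le {k : ℕ} {ε K : ℝ} {u : ℝ → ℝ}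
    (h : HasDecomposition (k + 2) ε K u) (hε : 0 < ε) (hε1 : ε ≤ 1)
    {x : ℝ} (hx : x ∈ Icc (0 : ℝ) 1) :
    D (k + 1) u x ^ 2 ≤ 3 * K ^ 2 * (1 + (ε ^ (1 - (k : ℤ)) * Real.exp (-x / ε)) ^ 2 +
        (ε ^ (1 - (k : ℤ)) * Real.exp (-(1 - x) / ε)) ^ 2) ∧
      (ε * D (k + 2) u x) ^ 2 ≤ 3 * K ^ 2 * (1 + (ε ^ (1 - (k : ℤ)) * Real.exp (-x / ε)) ^ 2 +
        (ε ^ (1 - (k : ℤ)) * Real.exp (-(1 - x) / ε)) ^ 2) := by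
  have hK := h.nonneg
  have h1 := h.abs_D_le (j := k + 1) (by omega) hx
  have h2 := h.abs_D_le (j := k + 2) le_rfl hx
  have e1 : (2 : ℤ) - ((k + 1 : ℕ) : ℤ) = 1 - k := by push_cast; ring
  -- The factor `ε` in `w = εu''` pays for the additional derivative of the layer terms; on the
  -- smooth part it is bounded by 1.
  have e2 : ε * ε ^ ((2 : ℤ) - ((k + 2 : ℕ) : ℤ)) = ε ^ (1 - (k : ℤ)) := by
    rw [← zpow_one_add₀ hε.ne']; congr 1; push_cast; ring
  rw [e1] at h1
  set s := ε ^ (1 - (k : ℤ)) with hs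
  set a := Real.exp (-x / ε)
  set c := Real.exp (-(1 - x) / ε)
  have hsq : ∀ t : ℝ, |t| ≤ K * (1 + s * (a + c)) →
      t ^ 2 ≤ 3 * K ^ 2 * (1 + (s * a) ^ 2 + (s * c) ^ 2) := by
    intro t ht
    calc t ^ 2 ≤ (K * (1 + s * (a + c))) ^ 2 := sq_le_sq' (abs_le.1 ht).1 (abs_le.1 ht).2
      _ = K ^ 2 * (1 + s * a + s * c) ^ 2 := by ring
      _ ≤ K ^ 2 * (3 * (1 + (s * a) ^ 2 + (s * c) ^ 2)) :=
          mul_le_mul_of_nonneg_left (by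
            linarith [sq_nonneg (1 - s * a), sq_nonneg (1 - s * c),
              sq_nonneg (s * a - s * c)]) (sq_nonneg K)
      _ = _ := by ring
  refine ⟨hsq _ h1, hsq _ ?_⟩
  rw [abs_mul, abs_of_pos hε]
  calc ε * |D (k + 2) u x| ≤ ε * (K * (1 + ε ^ (2 - ((k + 2 : ℕ) : ℤ)) * (a + c))) :=
        mul_le_mul_of_nonneg_left h2 hε.le
    _ = K * (ε + (ε * ε ^ (2 - ((k + 2 : ℕ) : ℤ))) * (a + c)) := by ring
    _ ≤ K * (1 + s * (a + c)) := by
        rw [e2]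
        exact mul_le_mul_of_nonneg_left (by linarith) hK

/-- The weight `ε⁻¹` is the largest power that the squared layer function can carry uniformly: an
antiderivative is `-½ e^(-2x/ε)`. -/
theorem integral_exp_layer_left {ε : ℝ} (hε : 0 < ε) :
    ∫ x in (0 : ℝ)..1, ε⁻¹ * Real.exp (-x / ε) ^ 2 ≤ 1 / 2 := by
  have hd : ∀ x ∈ uIcc (0 : ℝ) 1, HasDerivAt (fun x => -(1 / 2) * Real.exp (-x / ε) ^ 2)
      (ε⁻¹ * Real.exp (-x / ε) ^ 2) x := by
    intro x _
    have h := ((((hasDerivAt_id x).neg.div_const ε).exp).pow 2).const_mul (-(1 / 2))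
    refine h.congr_deriv ?_
    simp
    field_simp
  rw [intervalIntegral.integral_eq_sub_of_hasDerivAt hd
    (Continuous.intervalIntegrable (by fun_prop) _ _)]
  simp only [neg_zero, zero_div, Real.exp_zero]
  linarith [sq_nonneg (Real.exp (-1 / ε))]

theorem integral_exp_layer_right {ε : ℝ} (hε : 0 < ε) :
    ∫ x in (0 : ℝ)..1, ε⁻¹ * Real.exp (-(1 - x) / ε) ^ 2 ≤ 1 / 2 := by
  have h := intervalIntegral.integral_comp_sub_left
    (fun x => ε⁻¹ * Real.exp (-x / ε) ^ 2) (a := 0) (b := 1) 1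
  simp only [sub_self, sub_zero] at h
  rw [h]
  exact integral_exp_layer_left hε

/-- Beyond the transition point the scaled layer function is bounded uniformly in `ε`. -/
theorem layer_decay {k : ℕ} (hk : 2 ≤ k) {ε τ y : ℝ} (hε : 0 < ε) (hε1 : ε ≤ 1)
    (hτ : τ = ε ^ (1 - 3 / (2 * (k : ℝ)))) (hy : τ ≤ y) :
    ε ^ (1 - (k : ℤ)) * Real.exp (-y / ε) ≤ ((k ^ 2).factorial : ℝ) := by
  have hk0 : (0 : ℝ) < k := by exact_mod_cast (by omega : 0 < k)
  set s := ε ^ (-(3 / (2 * (k : ℝ)))) with hs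
  have hs0 : 0 < s := Real.rpow_pos_of_pos hε _
  have hτs : τ / ε = s := by
    rw [hτ, hs, sub_eq_add_neg, Real.rpow_add hε, Real.rpow_one]
    field_simp
  -- With `s = τ/ε = ε^(-3/(2k))`, the power `k²` gives `ε^(-3k/2)`, which dominates `ε^(1-k)`. One
  -- term of the exponential series then beats it.
  have h1 : ε ^ (1 - (k : ℤ)) ≤ s ^ (k ^ 2) := by
    rw [← Real.rpow_natCast, hs, ← Real.rpow_mul hε.le, ← Real.rpow_intCast]
    refine Real.rpow_le_rpow_of_exponent_ge hε hε1 ?_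
    push_cast
    have : -(3 / (2 * (k : ℝ))) * (k : ℝ) ^ 2 = -(3 / 2) * k := by field_simp
    rw [this]
    linarith
  have h2 := Real.pow_div_factorial_le_exp s hs0.le (k ^ 2)
  rw [div_le_iff₀ (by positivity)] at h2
  have h3 : Real.exp (-y / ε) ≤ Real.exp (-s) := by
    rw [Real.exp_le_exp, ← hτs, neg_div]
    exact neg_le_neg (div_le_div_of_nonneg_right hy hε.le)
  calc ε ^ (1 - (k : ℤ)) * Real.exp (-y / ε)
      ≤ (Real.exp s * ((k ^ 2).factorial : ℝ)) * Real.exp (-s) :=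
        mul_le_mul (h1.trans h2) h3 (Real.exp_pos _).le (by positivity)
    _ = (Real.exp s * Real.exp (-s)) * ((k ^ 2).factorial : ℝ) := by ring
    _ = _ := by rw [← Real.exp_add, add_neg_cancel, Real.exp_zero, one_mul]

/-- The exponents add up to `(2k - 3) + (2 - 2k) = -1`. The choice of `τ` is made so that the layer
weight becomes the `ε⁻¹` of the exponential integrals. -/
theorem transition_pow {k : ℕ} (hk : 2 ≤ k) {ε τ : ℝ} (hε : 0 < ε)
    (hτ : τ = ε ^ (1 - 3 / (2 * (k : ℝ)))) : τ ^ (2 * k) * (ε ^ (1 - (k : ℤ))) ^ 2 = ε⁻¹ := by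
  have hk0 : (k : ℝ) ≠ 0 := by exact_mod_cast (by omega : k ≠ 0)
  rw [hτ, ← Real.rpow_natCast, ← Real.rpow_mul hε.le, ← Real.rpow_intCast,
    ← Real.rpow_natCast (_ ^ _) 2, ← Real.rpow_mul hε.le, ← Real.rpow_add hε,
    ← Real.rpow_neg_one]
  congr 1
  push_cast
  field_simp
  ring

/-! ### The meshes -/

theorem isMesh_uniformMesh {N : ℕ} (hN : 1 ≤ N) : IsMesh N (uniformMesh N) := by
  have hN0 : (0 : ℝ) < N := by exact_mod_cast hN
  refine ⟨by simp [uniformMesh], by simp [uniformMesh, hN0.ne'], fun i _ => ?_⟩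
  simp only [uniformMesh]
  exact div_lt_div_of_pos_right (by push_cast; linarith) hN0

section LayerMesh

variable {τ : ℝ} {M N i : ℕ}

theorem layerMesh_of_le (hi : i ≤ M) : layerMesh τ M N i = i * (τ / M) := if_pos hi

/-- Adjacent branches agree at the transition index, so one formula covers both ends of every coarse
interval. -/
theorem layerMesh_of_mem (hM : 1 ≤ M) (hi : M ≤ i) (hi' : i ≤ M + N) :
    layerMesh τ M N i = τ + ((i : ℝ) - M) * ((1 - 2 * τ) / N) := by
  rcases hi.eq_or_lt with rfl | h
  · have : (M : ℝ) ≠ 0 := by exact_mod_cast (by omega : M ≠ 0)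
    rw [layerMesh_of_le le_rfl]
    field_simp
    ring
  · rw [layerMesh, if_neg (by omega), if_pos hi']

theorem layerMesh_of_ge (hM : 1 ≤ M) (hN : 1 ≤ N) (hi : M + N ≤ i) :
    layerMesh τ M N i = 1 - τ + ((i : ℝ) - M - N) * (τ / M) := by
  rcases hi.eq_or_lt with rfl | h
  · have : (N : ℝ) ≠ 0 := by exact_mod_cast (by omega : N ≠ 0)
    rw [layerMesh_of_mem hM (by omega) le_rfl]
    push_cast
    field_simp
    ring
  · rw [layerMesh, if_neg (by omega), if_neg (by omega)]

/-- Every interval of the layer mesh is a fine one, or a coarse one away from the boundary. -/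
theorem layerMesh_interval (hM : 1 ≤ M) (hN : 1 ≤ N) (hτ1 : τ < 1 / 2) (i : ℕ) :
    layerMesh τ M N (i + 1) - layerMesh τ M N i = τ / M ∨
      (layerMesh τ M N (i + 1) - layerMesh τ M N i = (1 - 2 * τ) / N ∧
        τ ≤ layerMesh τ M N i ∧ layerMesh τ M N (i + 1) ≤ 1 - τ) := by
  rcases le_or_gt (i + 1) M with h | h
  · left
    rw [layerMesh_of_le h, layerMesh_of_le (by omega)]
    push_cast; ring
  rcases le_or_gt (i + 1) (M + N) with h' | h'
  · right
    have hN0 : (0 : ℝ) < N := by exact_mod_cast hN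
    have hH : 0 ≤ (1 - 2 * τ) / N := div_nonneg (by linarith) hN0.le
    have hMi : (M : ℝ) ≤ i := by exact_mod_cast (by omega : M ≤ i)
    have hiN : (i : ℝ) + 1 ≤ M + N := by exact_mod_cast h'
    rw [layerMesh_of_mem hM (by omega) h', layerMesh_of_mem hM (by omega) (by omega)]
    refine ⟨by push_cast; ring, ?_, ?_⟩
    · linarith [mul_nonneg (sub_nonneg.2 hMi) hH]
    · have h1 : (((i + 1 : ℕ) : ℝ) - M) * ((1 - 2 * τ) / N) ≤ N * ((1 - 2 * τ) / N) :=
        mul_le_mul_of_nonneg_right (by push_cast; linarith) hH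
      rw [mul_div_cancel₀ _ hN0.ne'] at h1
      linarith
  · left
    rw [layerMesh_of_ge hM hN (by omega), layerMesh_of_ge hM hN (by omega)]
    push_cast; ring

theorem isMesh_layerMesh (hM : 1 ≤ M) (hN : 1 ≤ N) (hτ : 0 < τ) (hτ1 : τ < 1 / 2) :
    IsMesh (M + N + M) (layerMesh τ M N) := by
  have hM0 : (0 : ℝ) < M := by exact_mod_cast hM
  have hN0 : (0 : ℝ) < N := by exact_mod_cast hN
  refine ⟨by simp [layerMesh_of_le], ?_, fun i _ => ?_⟩
  · rw [layerMesh_of_ge hM hN (by omega)]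
    push_cast
    field_simp
    ring
  · rw [← sub_pos]
    rcases layerMesh_interval hM hN hτ1 i with h | ⟨h, -⟩ <;> rw [h]
    · positivity
    · exact div_pos (by linarith) hN0

end LayerMesh

/-- The integrable majorant of the scaled derivatives on the layer mesh. -/
theorem layer_majorant {k : ℕ} (hk : 2 ≤ k) {ε τ H h α K y t z : ℝ} (hε : 0 < ε) (hε1 : ε ≤ 1)
    (hτ : τ = ε ^ (1 - 3 / (2 * (k : ℝ)))) (hτ1 : τ ≤ 1) (hα : 0 < α) (hH : 0 < H) (hh0 : 0 < h)
    (hh : h ≤ α * H * τ ∨ h = H ∧ τ ≤ y ∧ τ ≤ 1 - y) (hz : z = ((k ^ 2).factorial : ℝ))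
    (ht : t ^ 2 ≤ 3 * K ^ 2 * (1 + (ε ^ (1 - (k : ℤ)) * Real.exp (-y / ε)) ^ 2 +
        (ε ^ (1 - (k : ℤ)) * Real.exp (-(1 - y) / ε)) ^ 2)) :
    h ^ (2 * k) * t ^ 2 ≤ 3 * K ^ 2 * H ^ (2 * k) * ((1 + 2 * z ^ 2) + α ^ (2 * k) *
      (1 + (ε⁻¹ * Real.exp (-y / ε) ^ 2 + ε⁻¹ * Real.exp (-(1 - y) / ε) ^ 2))) := by
  have hτ0 : 0 < τ := hτ ▸ Real.rpow_pos_of_pos hε _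
  refine (mul_le_mul_of_nonneg_left ht (by positivity)).trans ?_
  rcases hh with hh | ⟨rfl, hy, hy'⟩
  -- Fine interval: `τ^(2k)` turns both layer weights into `ε⁻¹`, wherever `y` lies.
  · have h1 : h ^ (2 * k) ≤ (α * H * τ) ^ (2 * k) := pow_le_pow_left₀ hh0.le hh _
    have h2 : τ ^ (2 * k) ≤ 1 := pow_le_one₀ hτ0.le hτ1
    have h3 := transition_pow hk hε hτ
    calc _ ≤ (α * H * τ) ^ (2 * k) * (3 * K ^ 2 *
          (1 + (ε ^ (1 - (k : ℤ)) * Real.exp (-y / ε)) ^ 2 +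
          (ε ^ (1 - (k : ℤ)) * Real.exp (-(1 - y) / ε)) ^ 2)) :=
          mul_le_mul_of_nonneg_right h1 (by positivity)
      _ = 3 * K ^ 2 * H ^ (2 * k) * (α ^ (2 * k) * (τ ^ (2 * k) +
          (τ ^ (2 * k) * (ε ^ (1 - (k : ℤ))) ^ 2 * Real.exp (-y / ε) ^ 2 +
          τ ^ (2 * k) * (ε ^ (1 - (k : ℤ))) ^ 2 * Real.exp (-(1 - y) / ε) ^ 2))) := by
          rw [mul_pow, mul_pow]; ring
      _ ≤ 3 * K ^ 2 * H ^ (2 * k) * ((1 + 2 * z ^ 2) + α ^ (2 * k) *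
          (1 + (ε⁻¹ * Real.exp (-y / ε) ^ 2 + ε⁻¹ * Real.exp (-(1 - y) / ε) ^ 2))) := by
          rw [h3]
          refine mul_le_mul_of_nonneg_left ?_ (by positivity)
          refine le_trans ?_ (le_add_of_nonneg_left (by positivity))
          exact mul_le_mul_of_nonneg_left (by linarith) (by positivity)
  -- Coarse interval: `y` keeps distance `τ` from both ends, so both layers are bounded by the
  -- constant `z`.
  · have h1 : (ε ^ (1 - (k : ℤ)) * Real.exp (-y / ε)) ^ 2 ≤ z ^ 2 :=
      pow_le_pow_left₀ (by positivity) (hz ▸ layer_decay hk hε hε1 hτ hy) 2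
    have h2 : (ε ^ (1 - (k : ℤ)) * Real.exp (-(1 - y) / ε)) ^ 2 ≤ z ^ 2 :=
      pow_le_pow_left₀ (by positivity) (hz ▸ layer_decay hk hε hε1 hτ hy') 2
    have h3 : 0 ≤ α ^ (2 * k) *
      (1 + (ε⁻¹ * Real.exp (-y / ε) ^ 2 + ε⁻¹ * Real.exp (-(1 - y) / ε) ^ 2)) := by positivity
    calc _ = 3 * K ^ 2 * h ^ (2 * k) * (1 + (ε ^ (1 - (k : ℤ)) * Real.exp (-y / ε)) ^ 2 +
          (ε ^ (1 - (k : ℤ)) * Real.exp (-(1 - y) / ε)) ^ 2) := by ring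
      _ ≤ _ := mul_le_mul_of_nonneg_left (by linarith) (by positivity)

theorem integral_layer_majorant_le {ε a c e : ℝ} (hε : 0 < ε) (ha : 0 ≤ a) (he : 0 ≤ e) :
    ∫ y in (0 : ℝ)..1, a * (c + e *
      (1 + (ε⁻¹ * Real.exp (-y / ε) ^ 2 + ε⁻¹ * Real.exp (-(1 - y) / ε) ^ 2))) ≤
      a * (c + 2 * e) := by
  have i1 : IntervalIntegrable (fun y => ε⁻¹ * Real.exp (-y / ε) ^ 2) volume 0 1 :=
    Continuous.intervalIntegrable (by fun_prop) _ _
  have i2 : IntervalIntegrable (fun y => ε⁻¹ * Real.exp (-(1 - y) / ε) ^ 2) volume 0 1 :=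
    Continuous.intervalIntegrable (by fun_prop) _ _
  rw [intervalIntegral.integral_const_mul, intervalIntegral.integral_add intervalIntegrable_const
    ((intervalIntegrable_const.add (i1.add i2)).const_mul e), intervalIntegral.integral_const_mul,
    intervalIntegral.integral_add intervalIntegrable_const (i1.add i2),
    intervalIntegral.integral_add i1 i2]
  simp only [intervalIntegral.integral_const, sub_zero, one_smul]
  have h1 := integral_exp_layer_left hε
  have h2 := integral_exp_layer_right hε
  refine mul_le_mul_of_nonneg_left ?_ ha
  have := mul_le_mul_of_nonneg_left (add_le_add h1 h2) he
  linarith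

/-! ### ### Conclusion for the two meshes -/

theorem SolvableWithError.mono {V : Submodule ℝ (ℝ → ℝ)} {ε B B' : ℝ} {b d f u : ℝ → ℝ}
    (h : SolvableWithError V ε b d f u B) (hB : B ≤ B') : SolvableWithError V ε b d f u B' :=
  ⟨h.1, fun uH wH hH => (h.2 uH wH hH).trans hB⟩

end VeryWeakLayer

theorem mainTheorem2
    (b d : ℝ → ℝ) (hb : ContDiffOn ℝ 2 b (Set.Icc 0 1)) (hd : ContinuousOn d (Set.Icc 0 1))
    (β δ : ℝ) (hβ : 0 < β) (hδ : 0 < δ)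
    (hbβ : ∀ x ∈ Set.Icc (0 : ℝ) 1, β ≤ b x)
    (hcoer : ∀ x ∈ Set.Icc (0 : ℝ) 1, δ < d x - 1 / 2 * VeryWeakLayer.D 2 b x) :
    -- linear elements on the uniform mesh with mesh size `H = 1 / N`
    (∀ K : ℝ, ∃ C : ℝ, 0 < C ∧
      ∀ ε : ℝ, 0 < ε → ε ≤ 1 → ∀ N : ℕ, 1 ≤ N → ∀ f u : ℝ → ℝ,
        VeryWeakLayer.IsSolution ε b d f u → VeryWeakLayer.HasDecomposition 3 ε K u →
        VeryWeakLayer.SolvableWithError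
          (VeryWeakLayer.feSpace N (VeryWeakLayer.uniformMesh N) 1) ε b d f u
          (C * (1 / (N : ℝ)))) ∧
    -- elements of order `k ≥ 2` on the mesh with transition point `τ = ε ^ (1 - 3 / (2 k))`,
    -- coarse mesh size `H` and fine mesh size `τ / M ≤ α H τ`
    (∀ k : ℕ, 2 ≤ k → ∀ α : ℝ, 0 < α → ∀ K : ℝ, ∃ C : ℝ, 0 < C ∧
      ∀ ε τ H : ℝ, 0 < ε → τ = ε ^ (1 - 3 / (2 * (k : ℝ))) → τ < 1 / 2 →
        ∀ M N : ℕ, 1 ≤ M → 1 ≤ N → H = (1 - 2 * τ) / N → τ / M ≤ α * H * τ →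
        ∀ f u : ℝ → ℝ,
          VeryWeakLayer.IsSolution ε b d f u → VeryWeakLayer.HasDecomposition (k + 2) ε K u →
          VeryWeakLayer.SolvableWithError
            (VeryWeakLayer.feSpace (M + N + M) (VeryWeakLayer.layerMesh τ M N) k) ε b d f u
            (C * H ^ k)) := by
  open VeryWeakLayer in
  have hb2 : ContDiffOn ℝ (2 : ℕ) b (Icc 0 1) := hb
  have hcoer' : ∀ x ∈ Icc (0 : ℝ) 1, 0 ≤ d x - 1 / 2 * D 2 b x :=
    fun x hx => (hδ.trans (hcoer x hx)).le
  obtain ⟨L, hL⟩ : ∃ L : ℝ, ∀ x ∈ Icc (0 : ℝ) 1, |b x| ≤ L ∧ |D 1 b x| ≤ L ∧ |d x| ≤ L := by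
    obtain ⟨L₁, h1⟩ := isCompact_Icc.exists_bound_of_continuousOn hb.continuousOn
    obtain ⟨L₂, h2⟩ := isCompact_Icc.exists_bound_of_continuousOn
      (hasWeakDeriv_D hb2 (j := 1) (by norm_num)).continuousOn
    obtain ⟨L₃, h3⟩ := isCompact_Icc.exists_bound_of_continuousOn hd
    exact ⟨max L₁ (max L₂ L₃), fun x hx => ⟨(h1 x hx).trans (le_max_left _ _),
      (h2 x hx).trans ((le_max_left _ _).trans (le_max_right _ _)),
      (h3 x hx).trans ((le_max_right _ _).trans (le_max_right _ _))⟩⟩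
  set Γ := 4 + 4 * (6 * L ^ 2 / β + 1 / 2) / min β 1 with hΓ
  have hsqrt : ∀ {a y : ℝ} {k : ℕ}, 0 ≤ y →
      Real.sqrt (Γ * (a * y ^ (2 * k))) ≤ (Real.sqrt (Γ * a) + 1) * y ^ k := by
    intro a y k hy
    have e : Γ * (a * y ^ (2 * k)) = Γ * a * (y ^ k) ^ 2 := by ring
    rw [e, Real.sqrt_mul' _ (sq_nonneg _), Real.sqrt_sq (pow_nonneg hy k)]
    exact mul_le_mul_of_nonneg_right (by linarith) (pow_nonneg hy k)
  -- The summand 1 keeps the constant positive even for `K = 0`.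
  refine ⟨fun K => ⟨Real.sqrt (Γ * (9 * K ^ 2)) + 1, by positivity, ?_⟩,
    fun k hk α hα K => ?_⟩
  · intro ε hε hε1 N hN f u hu hdec
    have hx := isMesh_uniformMesh hN
    have hH : ∀ i, uniformMesh N (i + 1) - uniformMesh N i = 1 / (N : ℝ) := fun i => by
      simp only [uniformMesh]; push_cast; ring
    have h := solvableWithError_feSpace hx le_rfl hb hd hβ hbβ hcoer' hL hu hdec.contDiffOn
      (.const (9 * K ^ 2 * (1 / (N : ℝ)) ^ (2 * 1)))
      (by simp : _ ≤ 9 * K ^ 2 * (1 / (N : ℝ)) ^ (2 * 1)) ?_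
    · refine h.mono ?_
      have := hsqrt (a := 9 * K ^ 2) (k := 1) (by positivity : 0 ≤ 1 / (N : ℝ))
      rwa [pow_one] at this
    · intro i hi y hy
      have hy' : y ∈ Icc (0 : ℝ) 1 := ⟨(hx.nonneg hi.le).trans hy.1, hy.2.trans (hx.le_one hi)⟩
      obtain ⟨h1, h2⟩ := HasDecomposition.sq_le (k := 1) hdec hε hε1 hy'
      have e1 : Real.exp (-y / ε) ≤ 1 :=
        Real.exp_le_one_iff.2 (div_nonpos_of_nonpos_of_nonneg (neg_nonpos.2 hy'.1) hε.le)
      have e2 : Real.exp (-(1 - y) / ε) ≤ 1 :=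
        Real.exp_le_one_iff.2 (div_nonpos_of_nonpos_of_nonneg (by linarith [hy'.2]) hε.le)
      -- For `k = 1` the factor `ε^(1-k)` is 1, so each of the three summands is at most 1 and no
      -- refinement is needed.
      have hb : 3 * K ^ 2 * (1 + (ε ^ (1 - ((1 : ℕ) : ℤ)) * Real.exp (-y / ε)) ^ 2 +
          (ε ^ (1 - ((1 : ℕ) : ℤ)) * Real.exp (-(1 - y) / ε)) ^ 2) ≤ 9 * K ^ 2 := by
        simp only [Nat.cast_one, sub_self, zpow_zero, one_mul]
        have e1' := pow_le_one₀ (n := 2) (Real.exp_pos _).le e1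
        have e2' := pow_le_one₀ (n := 2) (Real.exp_pos _).le e2
        calc _ ≤ 3 * K ^ 2 * 3 := mul_le_mul_of_nonneg_left (by linarith) (by positivity)
          _ = _ := by ring
      rw [hH, mul_comm (9 * K ^ 2)]
      exact ⟨mul_le_mul_of_nonneg_left (h1.trans hb) (by positivity),
        mul_le_mul_of_nonneg_left (h2.trans hb) (by positivity)⟩
  · obtain ⟨z, hz⟩ : ∃ z : ℝ, z = ((k ^ 2).factorial : ℝ) := ⟨_, rfl⟩
    refine ⟨Real.sqrt (Γ * (3 * K ^ 2 * (1 + 2 * z ^ 2 + 2 * α ^ (2 * k)))) + 1,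
      by positivity, ?_⟩
    intro ε τ H hε hτ hτ1 M N hM hN hH hMα f u hu hdec
    have hM0 : (0 : ℝ) < M := by exact_mod_cast hM
    have hN0 : (0 : ℝ) < N := by exact_mod_cast hN
    have hτ0 : 0 < τ := hτ ▸ Real.rpow_pos_of_pos hε _
    have hH0 : 0 < H := hH ▸ div_pos (by linarith) hN0
    -- The exponent of `τ` is nonnegative for `k ≥ 2`, so `ε > 1` would force `τ ≥ 1`, against `τ <
    -- 1/2`.
    have hε1 : ε ≤ 1 := by
      by_contra! hlt
      have hk2 : (2 : ℝ) ≤ k := by exact_mod_cast hk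
      have h0 : 0 ≤ 1 - 3 / (2 * (k : ℝ)) := by
        rw [sub_nonneg, div_le_one (by linarith)]; linarith
      have := Real.one_le_rpow hlt.le h0
      linarith
    have hx := isMesh_layerMesh hM hN hτ0 hτ1
    refine (solvableWithError_feSpace hx (by omega) hb hd hβ hbβ hcoer' hL hu hdec.contDiffOn
      (g := fun y => 3 * K ^ 2 * H ^ (2 * k) * ((1 + 2 * z ^ 2) + α ^ (2 * k) *
        (1 + (ε⁻¹ * Real.exp (-y / ε) ^ 2 + ε⁻¹ * Real.exp (-(1 - y) / ε) ^ 2))))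
      (.of_continuousOn (Continuous.continuousOn (by fun_prop)))
      (integral_layer_majorant_le hε (by positivity) (by positivity)) ?_).mono ?_
    · intro i hi y hy
      have hy' : y ∈ Icc (0 : ℝ) 1 := ⟨(hx.nonneg hi.le).trans hy.1, hy.2.trans (hx.le_one hi)⟩
      obtain ⟨h1, h2⟩ := hdec.sq_le hε hε1 hy'
      have hh : layerMesh τ M N (i + 1) - layerMesh τ M N i ≤ α * H * τ ∨
          layerMesh τ M N (i + 1) - layerMesh τ M N i = H ∧ τ ≤ y ∧ τ ≤ 1 - y := by
        rcases layerMesh_interval hM hN hτ1 i with h | ⟨h, ha, hc⟩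
        · exact .inl (h ▸ hMα)
        · exact .inr ⟨h.trans hH.symm, ha.trans hy.1, by linarith [hy.2]⟩
      have hpos := sub_pos.2 (hx.lt_succ i hi)
      exact ⟨layer_majorant hk hε hε1 hτ (by linarith) hα hH0 hpos hh hz h1,
        layer_majorant hk hε hε1 hτ (by linarith) hα hH0 hpos hh hz h2⟩
    · have e : 3 * K ^ 2 * H ^ (2 * k) * ((1 + 2 * z ^ 2) + 2 * α ^ (2 * k)) =
          3 * K ^ 2 * (1 + 2 * z ^ 2 + 2 * α ^ (2 * k)) * H ^ (2 * k) := by ring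
      rw [e]
      exact hsqrt hH0.le
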